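/- Let $n,m\ge 1$ be integers, $0<\alpha<mn$, $0<\gamma\le 1$, and let $K_\alpha$ be a (real- or complex-valued) measurable kernel on $\mathbb R^n\times(\mathbb R^n)^m$ such that, for some constant $c$, $$|K_\alpha(x,\vec y)|\le \frac{c}{(\sum_{i=1}^m|x-y_i|)^{mn-\alpha}}\quad\text{whenever }\sum_{i=1}^m|x-y_i|>0,$$ $$|K_\alpha(x,\vec y)-K_\alpha(x',\vec y)|\le \frac{c\,|x-x'|^\gamma}{(\sum_{i=1}^m|x-y_i|)^{mn-\alpha+\gamma}}\quad\text{whenever }\max_{1\le i\le m}|x-y_i|>2|x-x'|.$$ Let $T\vec f(x)=\int_{(\mathbb R^n)^m}K_\alpha(x,\vec y)\prod_{i=1}^m f_i(y_i)\,d\vec y$. Let $0<\delta<\min\{\gamma,mn-\alpha\}$, $\tilde\alpha=\alpha+\delta$, and let $\vec p=(p_1,\dots,p_m)$ with $1\le p_i\le\infty$, where $1/p=\sum_i 1/p_i$ and $p>n/\tilde\alpha$. Let $b_1,\dots,b_m\in\Lambda(\delta)$, that is, $|b_i(x)-b_i(y)|\le c_i|x-y|^\delta$ for all $x,y\in\mathbb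 R^n$. Let $\tilde\delta\le\delta$ be real, and let $w,v_1,\dots,v_m$ be weights (locally integrable functions that are positive almost everywhere) with $(w,\vec v)\in\mathbb H_m(\vec p,\tilde\alpha,\tilde\delta)$: there are numbers $0<\beta_i<n$ with $\sum_i\beta_i=\tilde\alpha$ and a constant $C_0$ such that for every ball $B=B(x_B,R)$ $$\frac{\|w\mathcal X_B\|_\infty}{|B|^{(\tilde\delta-\delta)/n}}\prod_{i=1}^m\left\|\frac{v_i^{-1}}{(|B|^{1/n}+|x_B-\cdot|)^{n-\beta_i+\delta/m}}\right\|_{L^{p_i'}(\mathbb R^n)}\le C_0 .$$ Suppose moreover that $v_i^{-p_i'}\in \mathrm{RH}_m$ for every $i$ with $1<p_i\le\infty$; here $u\in\mathrm{RH}_s$ means that $u$ is a weight and $\big(\frac1{|B|}\int_B u^s\big)^{1/s}\le \frac{C_1}{|B|}\int_B u$ for some constant $C_1$ and all balls $B$ (for $s=1$ the inequality is trivial). Let $T_{\mathbf b}\vec f=\sum_{j=1}^m[b_j,T]_j\vec f$, where $[b_j,T]_j\vec f=b_jT\vec f-T(f_1,\dots,b_jf_j,\dots,f_m)$, which formally equals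 $\int (b_j(x)-b_j(y_j))K_\alpha(x,\vec y)\prod_i f_i(y_i)\,d\vec y$. Then $T_{\mathbf b}$ is bounded from $\prod_iL^{p_i}(v_i^{p_i})$ to $\mathbb L_w(\tilde\delta)$ in the following sense. There is a constant $C>0$ such that for every $\vec f$ with $f_iv_i\in L^{p_i}$, $1\le i\le m$: (1) if the integrals defining $T\vec f(x)$ and $T(f_1,\dots,b_jf_j,\dots,f_m)(x)$, $1\le j\le m$, converge absolutely for almost every $x$, then $g=T_{\mathbf b}\vec f$ is locally integrable and, for every ball $B$, $$\frac{\|w\mathcal X_B\|_\infty}{|B|^{1+\tilde\delta/n}}\int_B|g(x)-g_B|\,dx\le C\prod_{i=1}^m\|f_iv_i\|_{p_i},\qquad g_B=\frac1{|B|}\int_B g; \tag{$*$}$$ (2) in every case $T_{\mathbf b}\vec f$ is defined modulo constants: there is a function $g$ on $\mathbb R^n$ such that for almost every $(x,z)$ $$g(x)-g(z)=\sum_{j=1}^m\int_{(\mathbb R^n)^m}\big[(b_j(x)-b_j(y_j))K_\alpha(x,\vec y)-(b_j(z)-b_j(y_j))K_\alpha(z,\vec y)\big]\prod_{i=1}^m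 f_i(y_i)\,d\vec y$$ with absolutely convergent integrals, and every such $g$ is locally integrable and satisfies $(*)$ for every ball $B$. -/

import Mathlib

open MeasureTheory
open scoped ENNReal NNReal

noncomputable section

namespace MultiFrac

/-- `ℝⁿ` with its Euclidean norm and Lebesgue measure. -/
abbrev Sp (n : ℕ) : Type := EuclideanSpace ℝ (Fin n)

/-- A weight: a locally integrable function that is positive (almost everywhere). -/
def IsWeight {n : ℕ} (u : Sp n → ℝ) : Prop :=
  LocallyIntegrable u volume ∧ ∀ᵐ x, 0 < u x

/-- The reverse Hölder class `RH_s`, the averages being taken over all balls.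
For `s = 1` the inequality is trivial. -/
def ReverseHolder {n : ℕ} (s : ℝ) (u : Sp n → ℝ) : Prop :=
  IsWeight u ∧ ∃ C : ℝ≥0, ∀ (x : Sp n) (R : ℝ), 0 < R →
    (⨍⁻ y in Metric.ball x R, ENNReal.ofReal (u y) ^ s ∂volume) ^ (1 / s) ≤
      C * ⨍⁻ y in Metric.ball x R, ENNReal.ofReal (u y) ∂volume

/-- The Lipschitz (Hölder) space `Λ(δ)`. -/
def MemLambda {n : ℕ} {𝕜 : Type*} [RCLike 𝕜] (δ : ℝ) (b : Sp n → 𝕜) : Prop :=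
  ∃ C : ℝ, ∀ x y, ‖b x - b y‖ ≤ C * ‖x - y‖ ^ δ

/-- `‖w 𝒳_B‖_∞` for the ball `B = B(x, R)`. -/
def ballSup {n : ℕ} (w : Sp n → ℝ) (x : Sp n) (R : ℝ) : ℝ≥0∞ :=
  eLpNorm ((Metric.ball x R).indicator w) ∞ volume

/-- `g` belongs to the weighted Lipschitz space `𝕃_w(δ)`, with constant (at most) `A`: `g` is locally
integrable and `‖w 𝒳_B‖_∞ |B|^{-1-δ/n} ∫_B |g - g_B| ≤ A` for every ball `B`. -/
def WeightedLipWith {n : ℕ} {𝕜 : Type*} [RCLike 𝕜] (w : Sp n → ℝ) (δ : ℝ) (A : ℝ≥0∞)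
    (g : Sp n → 𝕜) : Prop :=
  LocallyIntegrable g volume ∧ ∀ (x : Sp n) (R : ℝ), 0 < R →
    ballSup w x R / volume (Metric.ball x R) ^ (1 + δ / n) *
      ∫⁻ y in Metric.ball x R, ‖g y - ⨍ z in Metric.ball x R, g z‖ₑ ≤ A

/-- The class `ℍ_m(p⃗, β, δ')` of pairs `(w, v⃗)`, relative to the fixed number `δ`.  The `i`-th factor is
the `L^{p_i'}` norm of `v_i⁻¹ (|B|^{1/n} + |x_B - ·|)^{-(n - β_i + δ/m)}`, which is an essential
supremum if `p_i = 1`. -/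
def HClass {n m : ℕ} (p : Fin m → ℝ≥0∞) (β δ δ' : ℝ) (w : Sp n → ℝ) (v : Fin m → Sp n → ℝ) : Prop :=
  ∃ βs : Fin m → ℝ, (∀ i, 0 < βs i ∧ βs i < n) ∧ ∑ i, βs i = β ∧
    ∃ C : ℝ≥0, ∀ (x : Sp n) (R : ℝ), 0 < R →
      ballSup w x R / volume (Metric.ball x R) ^ ((δ' - δ) / n) *
        ∏ i, eLpNorm (fun y => (v i y)⁻¹ /
            (volume.real (Metric.ball x R) ^ (1 / (n : ℝ)) + ‖x - y‖) ^ (n - βs i + δ / m))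
          (p i).conjExponent volume ≤ C

/-- The size condition `|K(x, y⃗)| ≲ (∑ |x - y_i|)^{-(mn - α)}`, off the diagonal. -/
def SizeCondition {n m : ℕ} {𝕜 : Type*} [RCLike 𝕜] (α : ℝ) (K : Sp n → (Fin m → Sp n) → 𝕜) : Prop :=
  ∃ C : ℝ, ∀ (x : Sp n) (y : Fin m → Sp n), 0 < ∑ i, ‖x - y i‖ →
    ‖K x y‖ ≤ C / (∑ i, ‖x - y i‖) ^ (m * n - α)

/-- The smoothness condition of order `γ`
`|K(x, y⃗) - K(x', y⃗)| ≲ |x - x'|^γ (∑ |x - y_i|)^{-(mn - α + γ)}`,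
required whenever `max_i |x - y_i| > 2 |x - x'|`. -/
def SmoothnessCondition {n m : ℕ} {𝕜 : Type*} [RCLike 𝕜] (α γ : ℝ)
    (K : Sp n → (Fin m → Sp n) → 𝕜) : Prop :=
  ∃ C : ℝ, ∀ (x x' : Sp n) (y : Fin m → Sp n), (∃ i, 2 * ‖x - x'‖ < ‖x - y i‖) →
    ‖K x y - K x' y‖ ≤ C * ‖x - x'‖ ^ γ / (∑ i, ‖x - y i‖) ^ (m * n - α + γ)

/-- The integrand `K(x, y⃗) ∏ f_i(y_i)`. -/
def opIntegrand {n m : ℕ} {𝕜 : Type*} [RCLike 𝕜] (K : Sp n → (Fin m → Sp n) → 𝕜)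
    (f : Fin m → Sp n → 𝕜) (x : Sp n) (y : Fin m → Sp n) : 𝕜 :=
  K x y * ∏ i, f i (y i)

/-- The multilinear operator with kernel `K`. -/
def op {n m : ℕ} {𝕜 : Type*} [RCLike 𝕜] (K : Sp n → (Fin m → Sp n) → 𝕜)
    (f : Fin m → Sp n → 𝕜) (x : Sp n) : 𝕜 :=
  ∫ y, opIntegrand K f x y

/-- The tuple `(f_1, …, b f_j, …, f_m)`. -/
def mulEntry {n m : ℕ} {𝕜 : Type*} [RCLike 𝕜] (b : Sp n → 𝕜) (j : Fin m)
    (f : Fin m → Sp n → 𝕜) : Fin m → Sp n → 𝕜 :=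
  Function.update f j (fun y => b y * f j y)

/-- The commutator `[b, T]_j` in the `j`-th entry. -/
def commutatorAt {n m : ℕ} {𝕜 : Type*} [RCLike 𝕜] (b : Sp n → 𝕜)
    (T : (Fin m → Sp n → 𝕜) → Sp n → 𝕜) (j : Fin m) (f : Fin m → Sp n → 𝕜) (x : Sp n) : 𝕜 :=
  b x * T f x - T (mulEntry b j f) x

/-- The sum commutator `T_b = ∑ j, [b_j, T]_j` of the operator with kernel `K`. -/
def sumCommutator {n m : ℕ} {𝕜 : Type*} [RCLike 𝕜] (K : Sp n → (Fin m → Sp n) → 𝕜)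
    (b : Fin m → Sp n → 𝕜) (f : Fin m → Sp n → 𝕜) (x : Sp n) : 𝕜 :=
  ∑ j, commutatorAt (b j) (op K) j f x

/-- `f` is in the pointwise domain of the sum commutator: for almost every `x` all the integrals in
its definition converge absolutely. -/
def SumCommutatorConverges {n m : ℕ} {𝕜 : Type*} [RCLike 𝕜] (K : Sp n → (Fin m → Sp n) → 𝕜)
    (b : Fin m → Sp n → 𝕜) (f : Fin m → Sp n → 𝕜) : Prop :=
  ∀ᵐ x : Sp n, Integrable (opIntegrand K f x) ∧
    ∀ j, Integrable (opIntegrand K (mulEntry (b j) j f) x)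

/-- The integrand `(b_j(x) - b_j(y_j)) K(x, y⃗) ∏ f_i(y_i)` of the `j`-th commutator. -/
def commIntegrand {n m : ℕ} {𝕜 : Type*} [RCLike 𝕜] (K : Sp n → (Fin m → Sp n) → 𝕜)
    (b : Fin m → Sp n → 𝕜) (f : Fin m → Sp n → 𝕜) (j : Fin m) (x : Sp n) (y : Fin m → Sp n) : 𝕜 :=
  (b j x - b j (y j)) * K x y * ∏ i, f i (y i)

/-- `g` is the sum commutator of `f` modulo constants: for almost every pair `(x, z)` the difference
of the integrands at `x` and at `z` is absolutely integrable (though the two integrands need not be),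
and `g(x) - g(z)` is its integral.  Elements of `𝕃_w(δ)` matter only modulo constants, and this
determines `g` almost everywhere up to a constant. -/
def IsSumCommutatorModConst {n m : ℕ} {𝕜 : Type*} [RCLike 𝕜] (K : Sp n → (Fin m → Sp n) → 𝕜)
    (b : Fin m → Sp n → 𝕜) (f : Fin m → Sp n → 𝕜) (g : Sp n → 𝕜) : Prop :=
  ∀ᵐ q : Sp n × Sp n,
    (∀ j, Integrable (fun y => commIntegrand K b f j q.1 y - commIntegrand K b f j q.2 y)) ∧
    g q.1 - g q.2 = ∑ j, ∫ y, (commIntegrand K b f j q.1 y - commIntegrand K b f j q.2 y)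

end MultiFrac

end

/-! Write `Φ_j(x, y) = (b_j(x) - b_j(y_j)) K(x, y) ∏ f_i(y_i)`. Everything follows from bounding the
differences `Φ_j(x, ·) - Φ_j(z, ·)` for `x`, `z` in a ball `B = B(x₀, R)`, with the `y`-space split
into the cube `(5B)^m` and its complement. Put `S = ∑ |x - y_i|`.

Near the ball no cancellation between `x` and `z` is used. The Lipschitz factor improves the kernel
to `S^{-(mn-α-δ)}`, which is at most `∏ |x - y_i|^{-λ_i}` for any `λ_i ≥ 0` with sum `mn - α - δ`.
Hölder with `m` equal exponents reduces the integral over `B` to `L^m` norms of single fractional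
integrals. These are controlled by a Young-type inequality (`lintegral_rpow_lintegral_mul_mul_le`)
with `f_i v_i` in `L^{p_i}` and `v_i⁻¹` in `L^{m p_i'}`, and `RH_m` brings the latter norm back to
`L^{p_i'}`. It needs `λ_i < n(1 - (1 - 1/m)/p_i)`; such exponents exist because `p > n/(α + δ)`
(`exists_split_exponents`).

Away from the ball, smoothness of `K` and of `b_j` bounds the difference by `R^δ S^{-(mn-α)}` times
`∏ |f_i(y_i)|`. Since `S` dominates every `|B|^{1/n} + |x₀ - y_i|`, this power splits with the
exponents `n - β_i + δ/m`, whose sum is `mn - α`, and Hölder in each variable produces exactly the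
factors in `ℍ_m`.

Hence `|g(x) - g(z)|` is at most a local term in `x`, one in `z`, and a constant. Averaging in `z`
and integrating in `x` gives the oscillation bound
(`HasDifferences.lintegral_ball_enorm_sub_average_le`). Only differences of `g` enter, so `g` needs
to be known only modulo constants, and the case of convergent integrals is a special case. -/

noncomputable section

namespace MultiFrac

/-! ### Integral inequalities: Tonelli, Jensen, powers of the distance, Young. -/

/-- Tonelli's theorem for a product of functions of separate variables. -/
theorem lintegral_fin_prod {m : ℕ} {E : Type*} [MeasurableSpace E] (μ : Measure E) [SigmaFinite μ]
    (f : Fin m → E → ℝ≥0∞) (hf : ∀ i, AEMeasurable (f i) μ) :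
    ∫⁻ y, ∏ i, f i (y i) ∂(Measure.pi fun _ => μ) = ∏ i, ∫⁻ x, f i x ∂μ := by
  induction m with
  | zero => simp
  | succ m ih =>
    have h := ((measurePreserving_piFinSuccAbove (fun _ : Fin (m + 1) => μ) 0).symm)
    rw [← h.lintegral_comp_emb (MeasurableEquiv.measurableEmbedding _)]
    simp_rw [MeasurableEquiv.piFinSuccAbove_symm_apply, Fin.insertNthEquiv,
      Fin.prod_univ_succ, Fin.insertNth_zero]
    simp only [Equiv.coe_fn_mk, Fin.cons_zero, Fin.cons_succ]
    rw [← ih _ fun i => hf i.succ]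
    refine lintegral_prod_mul (f := f 0)
      (g := fun y : Fin m → E => ∏ i, f (Fin.succ i) (y i)) (hf 0) ?_
    exact Finset.aemeasurable_fun_prod _ fun i _ =>
      (hf i.succ).comp_quasiMeasurePreserving (Measure.quasiMeasurePreserving_eval _ i)

/-- Jensen's inequality for the measure with density `g`, not normalised. -/
theorem rpow_lintegral_mul_le {E : Type*} [MeasurableSpace E] {μ : Measure E} {r : ℝ} (hr : 1 ≤ r)
    {h g : E → ℝ≥0∞} (hh : AEMeasurable h μ) (hg : AEMeasurable g μ) :
    (∫⁻ x, h x * g x ∂μ) ^ r ≤ (∫⁻ x, h x ^ r * g x ∂μ) * (∫⁻ x, g x ∂μ) ^ (r - 1) := by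
  have hr0 : 0 < r := by linarith
  have hs : 0 ≤ 1 - 1 / r := by
    rw [sub_nonneg, div_le_one hr0]; exact hr
  -- Hölder for `h g = (h^r g)^{1/r} g^{1-1/r}`, in a form that admits the weight `1 - 1/r = 0`.
  have key := ENNReal.lintegral_mul_norm_pow_le (μ := μ) (p := 1 / r) (q := 1 - 1 / r)
    (f := fun x => h x ^ r * g x) (g := g) ((hh.pow_const r).mul hg) hg (by positivity) hs (by ring)
  have e : ∀ x, (h x ^ r * g x) ^ (1 / r) * g x ^ (1 - 1 / r) = h x * g x := by
    intro x
    rw [ENNReal.mul_rpow_of_nonneg _ _ (by positivity), ← ENNReal.rpow_mul, mul_assoc,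
      ← ENNReal.rpow_add_of_nonneg _ _ (by positivity) hs]
    have h1 : r * (1 / r) = 1 := by field_simp
    have h2 : 1 / r + (1 - 1 / r) = 1 := by ring
    rw [h1, h2, ENNReal.rpow_one, ENNReal.rpow_one]
  simp_rw [e] at key
  calc (∫⁻ x, h x * g x ∂μ) ^ r
      ≤ ((∫⁻ x, h x ^ r * g x ∂μ) ^ (1 / r) * (∫⁻ x, g x ∂μ) ^ (1 - 1 / r)) ^ r := by gcongr
    _ = _ := by
      rw [ENNReal.mul_rpow_of_nonneg _ _ hr0.le, ← ENNReal.rpow_mul, ← ENNReal.rpow_mul]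
      have h1 : 1 / r * r = 1 := by field_simp
      have h2 : (1 - 1 / r) * r = r - 1 := by field_simp
      rw [h1, h2, ENNReal.rpow_one]

/-- The mass of a power of the distance on a ball, uniformly in the pole. -/
theorem exists_lintegral_ball_rpow_le {n : ℕ} (hn : 1 ≤ n) {σ : ℝ} (hσ : 0 ≤ σ) (hσn : σ < n) :
    ∃ C : ℝ≥0, ∀ (x₀ y : Sp n) (ρ : ℝ), 0 < ρ →
      ∫⁻ x in Metric.ball x₀ ρ, ‖x - y‖ₑ ^ (-σ) ≤ C * ENNReal.ofReal ρ ^ (n - σ) := by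
  have hfr : Module.finrank ℝ (Sp n) = n := by simp
  have : Nontrivial (Sp n) := Module.nontrivial_of_finrank_pos (R := ℝ) (by omega)
  have hmeas : Measurable fun x : Sp n => ‖x‖ₑ ^ (-σ) := by fun_prop
  obtain ⟨I, hI⟩ : ∃ I : ℝ≥0, ∫⁻ x in Metric.ball (0 : Sp n) 1, ‖x‖ₑ ^ (-σ) = I := by
    have h := integrableOn_ball_of_norm_le_rpow (μ := (volume : Measure (Sp n))) (r := 1) (C := 1)
      (α := σ) (f := fun x : Sp n => ‖x‖ ^ (-σ)) (by rw [hfr]; exact hn) (by rw [hfr]; exact hσn)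
      (Filter.Eventually.of_forall fun x => by
        rw [one_mul, Real.norm_of_nonneg (by positivity)])
      (measurable_norm.pow_const _).aestronglyMeasurable
    have h2 := h.lintegral_lt_top
    refine ⟨_, (ENNReal.coe_toNNReal (ne_of_lt (lt_of_le_of_lt (le_of_eq ?_) h2))).symm⟩
    refine lintegral_congr_ae (ae_restrict_of_ae ?_)
    filter_upwards [compl_mem_ae_iff.2 (measure_singleton (0 : Sp n))] with x hx
    have hx : 0 < ‖x‖ := norm_pos_iff.2 hx
    rw [← ofReal_norm, ENNReal.ofReal_rpow_of_pos hx]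
  have hscale : ∀ ρ : ℝ, 0 < ρ → ∫⁻ x in Metric.ball (0 : Sp n) ρ, ‖x‖ₑ ^ (-σ) =
      I * ENNReal.ofReal ρ ^ (n - σ) := by
    intro ρ hρ
    have h := Measure.map_addHaar_smul (volume : Measure (Sp n)) hρ.ne'
    have hemb : MeasurableEmbedding fun x : Sp n => ρ • x :=
      (Homeomorph.smulOfNeZero ρ hρ.ne').measurableEmbedding
    have h1 : ∫⁻ x in Metric.ball (0 : Sp n) ρ, ‖x‖ₑ ^ (-σ)
        ∂(Measure.map (ρ • ·) (volume : Measure (Sp n))) =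
        ENNReal.ofReal ρ ^ (-σ) * I := by
      rw [Measure.restrict_map hemb.measurable measurableSet_ball, hemb.lintegral_map]
      have : (fun x : Sp n => ρ • x) ⁻¹' Metric.ball 0 ρ = Metric.ball 0 1 := by
        ext x
        simp [norm_smul, abs_of_pos hρ, hρ]
      rw [this, ← hI, ← lintegral_const_mul _ hmeas]
      refine lintegral_congr fun x => ?_
      rw [enorm_smul, ENNReal.mul_rpow_of_ne_top (by simp) (by simp),
        Real.enorm_of_nonneg hρ.le]
    rw [h, Measure.restrict_smul, lintegral_smul_measure, hfr] at h1
    have hρ0 : ENNReal.ofReal ρ ≠ 0 := by simpa using hρ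
    have e1 : ENNReal.ofReal |(ρ ^ n)⁻¹| = (ENNReal.ofReal ρ ^ (n : ℝ))⁻¹ := by
      rw [abs_of_pos (by positivity), ENNReal.ofReal_inv_of_pos (by positivity),
        ENNReal.ofReal_pow hρ.le, ENNReal.rpow_natCast]
    rw [e1, smul_eq_mul] at h1
    have e2 : ENNReal.ofReal ρ ^ (n : ℝ) ≠ 0 := by simp [hρ]
    have e3 : ENNReal.ofReal ρ ^ (n : ℝ) ≠ ∞ := by finiteness
    calc _ = ENNReal.ofReal ρ ^ (n : ℝ) * ((ENNReal.ofReal ρ ^ (n : ℝ))⁻¹ *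
          ∫⁻ x in Metric.ball (0 : Sp n) ρ, ‖x‖ₑ ^ (-σ)) := by
          rw [← mul_assoc, ENNReal.mul_inv_cancel e2 e3, one_mul]
      _ = _ := by
          rw [h1, sub_eq_add_neg, ENNReal.rpow_add _ _ hρ0 ENNReal.ofReal_ne_top]; ring
  have hvol : volume (Metric.ball (0 : Sp n) 1) ≠ ∞ := measure_ball_lt_top.ne
  refine ⟨I + (volume (Metric.ball (0 : Sp n) 1)).toNNReal, fun x₀ y ρ hρ => ?_⟩
  have hρ0 : ENNReal.ofReal ρ ≠ 0 := by simpa using hρ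
  -- Within `ρ` of the pole the mass is that of a centred ball; farther away the integrand is at
  -- most `ρ^{-σ}`, so the remaining mass is at most `ρ^{-σ}` times the volume.
  have hpt : ∀ x ∈ Metric.ball x₀ ρ, ‖x - y‖ₑ ^ (-σ) ≤
      (Metric.ball y ρ).indicator (fun x => ‖x - y‖ₑ ^ (-σ)) x + ENNReal.ofReal ρ ^ (-σ) := by
    intro x _
    by_cases hx : x ∈ Metric.ball y ρ
    · rw [Set.indicator_of_mem hx]; exact le_self_add
    · rw [Set.indicator_of_notMem hx, zero_add]
      rw [Metric.mem_ball, not_lt, dist_eq_norm] at hx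
      rw [ENNReal.rpow_neg, ENNReal.rpow_neg, ENNReal.inv_le_inv, ← ofReal_norm]
      refine ENNReal.rpow_le_rpow ?_ hσ
      exact ENNReal.ofReal_le_ofReal hx
  calc ∫⁻ x in Metric.ball x₀ ρ, ‖x - y‖ₑ ^ (-σ)
      ≤ ∫⁻ x in Metric.ball x₀ ρ, ((Metric.ball y ρ).indicator (fun x => ‖x - y‖ₑ ^ (-σ)) x
          + ENNReal.ofReal ρ ^ (-σ)) := setLIntegral_mono' measurableSet_ball hpt
    _ = (∫⁻ x in Metric.ball x₀ ρ, (Metric.ball y ρ).indicator (fun x => ‖x - y‖ₑ ^ (-σ)) x)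
          + ENNReal.ofReal ρ ^ (-σ) * volume (Metric.ball x₀ ρ) := by
        rw [lintegral_add_right _ measurable_const, setLIntegral_const]
    _ ≤ (∫⁻ x, (Metric.ball y ρ).indicator (fun x => ‖x - y‖ₑ ^ (-σ)) x)
          + ENNReal.ofReal ρ ^ (-σ) * volume (Metric.ball x₀ ρ) := by
        gcongr; exact Measure.restrict_le_self
    _ = I * ENNReal.ofReal ρ ^ (n - σ) +
          ENNReal.ofReal ρ ^ (-σ) * volume (Metric.ball x₀ ρ) := by
        rw [← hscale ρ hρ, ← lintegral_indicator measurableSet_ball]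
        rw [← lintegral_sub_right_eq_self ((Metric.ball (0 : Sp n) ρ).indicator _) y]
        congr 2 with x
        simp [Set.indicator, dist_eq_norm]
    _ = _ := by
        rw [Measure.addHaar_ball _ _ hρ.le, hfr, ENNReal.ofReal_pow hρ.le, ENNReal.coe_add,
          ENNReal.coe_toNNReal hvol, sub_eq_add_neg,
          ENNReal.rpow_add _ _ hρ0 ENNReal.ofReal_ne_top, ENNReal.rpow_natCast]
        ring

/-- A Young-type inequality: an integral operator whose kernel `k` has its `s`-th power uniformly
integrable in either variable maps the products of `L^p` and `L^{r p'}` functions to `L^r`, where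
`1/s = 1/(r p) + 1/p'`. -/
theorem lintegral_rpow_lintegral_mul_mul_le {X Y : Type*} [MeasurableSpace X] [MeasurableSpace Y]
    {μ : Measure X} {ν : Measure Y} [SFinite μ] [SFinite ν] {k : X → Y → ℝ≥0∞}
    (hk : Measurable (Function.uncurry k)) {F u : Y → ℝ≥0∞} (hF : AEMeasurable F ν)
    (hu : AEMeasurable u ν) {p q : ℝ≥0∞} [hpq : ENNReal.HolderConjugate p q] {r s : ℝ} (hr : 1 ≤ r)
    (hs : s⁻¹ = p⁻¹.toReal / r + (1 - p⁻¹.toReal)) {κ : ℝ≥0∞}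
    (hκX : ∀ x, ∫⁻ y, k x y ^ s ∂ν ≤ κ) (hκY : ∀ y, ∫⁻ x, k x y ^ s ∂μ ≤ κ) :
    ∫⁻ x, (∫⁻ y, k x y * (F y * u y) ∂ν) ^ r ∂μ ≤
      κ ^ (r / s) * (eLpNorm F p ν ^ r * eLpNorm u (ENNReal.ofReal r * q) ν ^ r) := by
  have hr0 : 0 < r := by linarith
  have hkx : ∀ x, Measurable (k x) := fun x => hk.of_uncurry_left
  have swap : ∀ (t : ℝ) (h : Y → ℝ≥0∞), AEMeasurable h ν →
      ∫⁻ x, ∫⁻ y, k x y ^ t * h y ∂ν ∂μ = ∫⁻ y, h y * ∫⁻ x, k x y ^ t ∂μ ∂ν := by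
    intro t h hh
    rw [lintegral_lintegral_swap]
    · refine lintegral_congr fun y => ?_
      rw [lintegral_mul_const _ (hk.of_uncurry_right.pow_const t), mul_comm]
    · exact (hk.pow_const t).aemeasurable.mul
        (hh.comp_quasiMeasurePreserving Measure.quasiMeasurePreserving_snd)
  have swap_le : ∀ (h : Y → ℝ≥0∞), AEMeasurable h ν →
      ∫⁻ x, ∫⁻ y, k x y ^ s * h y ∂ν ∂μ ≤ (∫⁻ y, h y ∂ν) * κ := by
    intro h hh
    rw [swap s h hh]
    calc _ ≤ ∫⁻ y, h y * κ ∂ν := lintegral_mono fun y => by gcongr; exact hκY y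
      _ = _ := lintegral_mul_const'' _ hh
  -- Endpoint `p = 1`: here `s = r`, `u` is bounded, and Jensen is applied with density `F`.
  obtain rfl | hp1 := eq_or_ne p 1
  · obtain rfl : q = ∞ := (ENNReal.HolderConjugate.eq_top_iff_eq_one q 1).2 rfl
    have hsr : s = r := by
      have : s⁻¹ = r⁻¹ := by rw [hs]; simp
      exact inv_injective this
    subst hsr
    rw [ENNReal.mul_top (by simpa using hr0), div_self hr0.ne', ENNReal.rpow_one]
    set U := eLpNorm u ∞ ν
    have hU : ∀ᵐ y ∂ν, u y ≤ U := by
      simpa [U, eLpNorm_exponent_top] using ae_le_eLpNormEssSup (f := u) (μ := ν)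
    have hpt : ∀ x, (∫⁻ y, k x y * (F y * u y) ∂ν) ^ s ≤
        (∫⁻ y, k x y ^ s * F y ∂ν) * ((∫⁻ y, F y ∂ν) ^ (s - 1) * U ^ s) := by
      intro x
      calc (∫⁻ y, k x y * (F y * u y) ∂ν) ^ s ≤ (∫⁻ y, k x y * F y * U ∂ν) ^ s := by
            gcongr ?_ ^ s
            refine lintegral_mono_ae ?_
            filter_upwards [hU] with y hy
            rw [mul_assoc]
            gcongr
        _ = (∫⁻ y, k x y * F y ∂ν) ^ s * U ^ s := by
            rw [lintegral_mul_const'' (f := fun y => k x y * F y) _ ((hkx x).aemeasurable.mul hF),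
              ENNReal.mul_rpow_of_nonneg _ _ hr0.le]
        _ ≤ (∫⁻ y, k x y ^ s * F y ∂ν) * (∫⁻ y, F y ∂ν) ^ (s - 1) * U ^ s := by
            gcongr
            exact rpow_lintegral_mul_le hr (hkx x).aemeasurable hF
        _ = _ := mul_assoc _ _ _
    have hm : AEMeasurable (fun x => ∫⁻ y, k x y ^ s * F y ∂ν) μ :=
      ((hk.pow_const s).aemeasurable.mul
        (hF.comp_quasiMeasurePreserving Measure.quasiMeasurePreserving_snd)).lintegral_prod_right'
    calc _ ≤ _ := lintegral_mono hpt
      _ = (∫⁻ x, ∫⁻ y, k x y ^ s * F y ∂ν ∂μ) * ((∫⁻ y, F y ∂ν) ^ (s - 1) * U ^ s) :=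
          lintegral_mul_const'' _ hm
      _ ≤ ((∫⁻ y, F y ∂ν) * κ) * ((∫⁻ y, F y ∂ν) ^ (s - 1) * U ^ s) := by
          gcongr; exact swap_le F hF
      _ = κ * ((∫⁻ y, F y ∂ν) ^ (1 : ℝ) * (∫⁻ y, F y ∂ν) ^ (s - 1) * U ^ s) := by
          rw [ENNReal.rpow_one]; ring
      _ = κ * (eLpNorm F 1 ν ^ s * U ^ s) := by
          rw [← ENNReal.rpow_add_of_nonneg _ _ zero_le_one (by linarith), eLpNorm_one_eq_lintegral_enorm]
          simp
  -- Endpoint `p = ∞`: here `s = 1`, `F` is bounded, and Jensen is applied with density `k x`.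
  obtain rfl | hpt := eq_or_ne p ∞
  · obtain rfl : q = 1 := (ENNReal.HolderConjugate.eq_top_iff_eq_one ∞ q).1 rfl
    have hs1 : s = 1 := by
      have : s⁻¹ = 1⁻¹ := by rw [hs]; simp
      exact inv_injective this
    subst hs1
    simp only [ENNReal.rpow_one] at hκX hκY swap_le
    rw [mul_one, div_one]
    set Φ := eLpNorm F ∞ ν
    have hΦ : ∀ᵐ y ∂ν, F y ≤ Φ := by
      simpa [Φ, eLpNorm_exponent_top] using ae_le_eLpNormEssSup (f := F) (μ := ν)
    have hpt : ∀ x, (∫⁻ y, k x y * (F y * u y) ∂ν) ^ r ≤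
        (∫⁻ y, k x y * u y ^ r ∂ν) * (κ ^ (r - 1) * Φ ^ r) := by
      intro x
      calc (∫⁻ y, k x y * (F y * u y) ∂ν) ^ r ≤ (∫⁻ y, u y * k x y * Φ ∂ν) ^ r := by
            gcongr ?_ ^ r
            refine lintegral_mono_ae ?_
            filter_upwards [hΦ] with y hy
            calc k x y * (F y * u y) ≤ k x y * (Φ * u y) := by gcongr
              _ = _ := by ring
        _ = (∫⁻ y, u y * k x y ∂ν) ^ r * Φ ^ r := by
            rw [lintegral_mul_const'' (f := fun y => u y * k x y) _ (hu.mul (hkx x).aemeasurable),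
              ENNReal.mul_rpow_of_nonneg _ _ hr0.le]
        _ ≤ (∫⁻ y, u y ^ r * k x y ∂ν) * (∫⁻ y, k x y ∂ν) ^ (r - 1) * Φ ^ r := by
            gcongr
            exact rpow_lintegral_mul_le hr hu (hkx x).aemeasurable
        _ ≤ (∫⁻ y, u y ^ r * k x y ∂ν) * κ ^ (r - 1) * Φ ^ r := by
            gcongr
            exact hκX x
        _ = _ := by simp_rw [mul_assoc, mul_comm (k x _)]
    have hm : AEMeasurable (fun x => ∫⁻ y, k x y * u y ^ r ∂ν) μ :=
      (hk.aemeasurable.mul ((hu.pow_const r).comp_quasiMeasurePreserving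
        Measure.quasiMeasurePreserving_snd)).lintegral_prod_right'
    calc _ ≤ _ := lintegral_mono hpt
      _ = (∫⁻ x, ∫⁻ y, k x y * u y ^ r ∂ν ∂μ) * (κ ^ (r - 1) * Φ ^ r) :=
          lintegral_mul_const'' _ hm
      _ ≤ ((∫⁻ y, u y ^ r ∂ν) * κ) * (κ ^ (r - 1) * Φ ^ r) := by
          gcongr; exact swap_le _ (hu.pow_const r)
      _ = (κ ^ (1 : ℝ) * κ ^ (r - 1)) * (Φ ^ r * ∫⁻ y, u y ^ r ∂ν) := by
          rw [ENNReal.rpow_one]; ring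
      _ = _ := by
          rw [← ENNReal.rpow_add_of_nonneg _ _ zero_le_one (by linarith),
            eLpNorm_eq_lintegral_rpow_enorm_toReal (by simpa using hr0) ENNReal.ofReal_ne_top,
            ENNReal.toReal_ofReal hr0.le, ← ENNReal.rpow_mul]
          simp [hr0.ne']
  have hq1 : q ≠ 1 := fun h => hpt ((ENNReal.HolderConjugate.eq_top_iff_eq_one p q).2 h)
  have hqt : q ≠ ∞ := fun h => hp1 ((ENNReal.HolderConjugate.eq_top_iff_eq_one q p).1 h)
  have hPQ := ENNReal.HolderConjugate.toReal_of_ne_top (p := p) (q := q) hpt hqt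
  have hp0 : p ≠ 0 := ENNReal.HolderConjugate.ne_zero p q
  have hq0 : q ≠ 0 := ENNReal.HolderConjugate.ne_zero q p
  have hrq0 : ENNReal.ofReal r * q ≠ 0 := mul_ne_zero (by simpa using hr0) hq0
  have hrqt : ENNReal.ofReal r * q ≠ ∞ := ENNReal.mul_ne_top ENNReal.ofReal_ne_top hqt
  rw [eLpNorm_eq_lintegral_rpow_enorm_toReal hp0 hpt,
    eLpNorm_eq_lintegral_rpow_enorm_toReal hrq0 hrqt, ENNReal.toReal_mul,
    ENNReal.toReal_ofReal hr0.le]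
  rw [ENNReal.toReal_inv] at hs
  simp only [enorm_eq_self]
  generalize p.toReal = P at *
  generalize q.toReal = Q at *
  have hP0 : 0 < P := hPQ.pos
  have hQ0 : 0 < Q := hPQ.symm.pos
  have hPQ1 : P⁻¹ + Q⁻¹ = 1 := hPQ.inv_add_inv_eq_one
  have hs' : s⁻¹ = P⁻¹ / r + Q⁻¹ := by rw [hs]; linarith
  have hs0 : 0 < s := by
    rw [← inv_pos, hs']; positivity
  have hs1 : s / (r * P) + s / Q = 1 := by
    have : s * s⁻¹ = 1 := mul_inv_cancel₀ hs0.ne'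
    rw [hs'] at this
    rw [← this]; field_simp
  set A : X → ℝ≥0∞ := fun x => ∫⁻ y, k x y ^ s * F y ^ P ∂ν
  set B : X → ℝ≥0∞ := fun x => ∫⁻ y, k x y ^ s * u y ^ (r * Q) ∂ν
  have hFP : AEMeasurable (fun y => F y ^ P) ν := hF.pow_const P
  have huQ : AEMeasurable (fun y => u y ^ Q) ν := hu.pow_const Q
  have hurQ : AEMeasurable (fun y => u y ^ (r * Q)) ν := hu.pow_const _
  have hA : AEMeasurable A μ := ((hk.pow_const s).aemeasurable.mul
    (hFP.comp_quasiMeasurePreserving Measure.quasiMeasurePreserving_snd)).lintegral_prod_right'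
  have hB : AEMeasurable B μ := ((hk.pow_const s).aemeasurable.mul
    (hurQ.comp_quasiMeasurePreserving Measure.quasiMeasurePreserving_snd)).lintegral_prod_right'
  set IF := ∫⁻ y, F y ^ P ∂ν
  -- Split `k = k^{s/(rP)} k^{s/Q}` and apply Hölder in `y`. The outer power `r` is then moved
  -- inside each factor by Jensen, with density `F^P` in the first and `k^s` in the second.
  have hpoint : ∀ x, (∫⁻ y, k x y * (F y * u y) ∂ν) ^ r ≤
      (A x * IF ^ (r - 1)) ^ (1 / P) * (B x * κ ^ (r - 1)) ^ (1 / Q) := by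
    intro x
    have h1 := ENNReal.lintegral_mul_le_Lp_mul_Lq ν hPQ
      (f := fun y => k x y ^ (s / (r * P)) * F y) (g := fun y => k x y ^ (s / Q) * u y)
      (((hkx x).pow_const _).aemeasurable.mul hF) (((hkx x).pow_const _).aemeasurable.mul hu)
    have e0 : ∀ y, k x y ^ (s / (r * P)) * F y * (k x y ^ (s / Q) * u y) =
        k x y * (F y * u y) := by
      intro y
      rw [mul_mul_mul_comm, ← ENNReal.rpow_add_of_nonneg _ _ (by positivity) (by positivity), hs1,
        ENNReal.rpow_one]
    have e1 : ∀ y, (k x y ^ (s / (r * P)) * F y) ^ P = k x y ^ (s / r) * F y ^ P := by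
      intro y
      rw [ENNReal.mul_rpow_of_nonneg _ _ hP0.le, ← ENNReal.rpow_mul]
      congr 2; field_simp
    have e2 : ∀ y, (k x y ^ (s / Q) * u y) ^ Q = u y ^ Q * k x y ^ s := by
      intro y
      rw [ENNReal.mul_rpow_of_nonneg _ _ hQ0.le, ← ENNReal.rpow_mul, mul_comm]
      congr 2; field_simp
    simp only [Pi.mul_apply, e0, e1, e2] at h1
    have hJ1 := rpow_lintegral_mul_le hr (((hkx x).pow_const (s / r)).aemeasurable (μ := ν)) hFP
    have hJ2 := rpow_lintegral_mul_le hr huQ (((hkx x).pow_const s).aemeasurable (μ := ν))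
    simp only [← ENNReal.rpow_mul, div_mul_cancel₀ _ hr0.ne', mul_comm Q r] at hJ1 hJ2
    have hJ2' : (∫⁻ y, u y ^ Q * k x y ^ s ∂ν) ^ r ≤ B x * κ ^ (r - 1) := by
      refine hJ2.trans ?_
      have : ∫⁻ y, u y ^ (r * Q) * k x y ^ s ∂ν = B x := lintegral_congr fun y => mul_comm _ _
      rw [this]
      gcongr
      exact hκX x
    calc _ ≤ ((∫⁻ y, k x y ^ (s / r) * F y ^ P ∂ν) ^ (1 / P) *
          (∫⁻ y, u y ^ Q * k x y ^ s ∂ν) ^ (1 / Q)) ^ r := by gcongr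
      _ = ((∫⁻ y, k x y ^ (s / r) * F y ^ P ∂ν) ^ r) ^ (1 / P) *
          ((∫⁻ y, u y ^ Q * k x y ^ s ∂ν) ^ r) ^ (1 / Q) := by
          rw [ENNReal.mul_rpow_of_nonneg _ _ hr0.le]
          simp only [← ENNReal.rpow_mul, mul_comm]
      _ ≤ _ := by gcongr
  have hcomb : ∀ a : ℝ≥0∞, a * a ^ (r - 1) = a ^ r := by
    intro a
    nth_rw 1 [← ENNReal.rpow_one a]
    rw [← ENNReal.rpow_add_of_nonneg _ _ zero_le_one (by linarith)]
    congr 1; ring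
  have hP1 : 1 / P + 1 / Q = 1 := by rw [one_div, one_div]; exact hPQ1
  -- Hölder in `x` with the same exponents `P` and `Q`, then Tonelli and the bound on `∫ k^s` in
  -- `x`. The powers of `κ` add up to `1/P + r/Q = r/s`.
  calc _ ≤ _ := lintegral_mono hpoint
    _ ≤ (∫⁻ x, A x * IF ^ (r - 1) ∂μ) ^ (1 / P) * (∫⁻ x, B x * κ ^ (r - 1) ∂μ) ^ (1 / Q) :=
        ENNReal.lintegral_mul_norm_pow_le (hA.mul_const _) (hB.mul_const _)
          (by positivity) (by positivity) hP1
    _ = ((∫⁻ x, A x ∂μ) * IF ^ (r - 1)) ^ (1 / P) * ((∫⁻ x, B x ∂μ) * κ ^ (r - 1)) ^ (1 / Q) := by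
        rw [lintegral_mul_const'' _ hA, lintegral_mul_const'' _ hB]
    _ ≤ ((IF * κ) * IF ^ (r - 1)) ^ (1 / P) *
          (((∫⁻ y, u y ^ (r * Q) ∂ν) * κ) * κ ^ (r - 1)) ^ (1 / Q) := by
        gcongr
        · exact swap_le _ hFP
        · exact swap_le _ hurQ
    _ = (κ * IF ^ r) ^ (1 / P) * (κ ^ r * ∫⁻ y, u y ^ (r * Q) ∂ν) ^ (1 / Q) := by
        rw [← hcomb IF, ← hcomb κ]
        congr 2 <;> ring
    _ = (κ ^ (1 / P) * κ ^ (r * (1 / Q))) *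
          (IF ^ (r * (1 / P)) * (∫⁻ y, u y ^ (r * Q) ∂ν) ^ (1 / Q)) := by
        rw [ENNReal.mul_rpow_of_nonneg _ _ (by positivity),
          ENNReal.mul_rpow_of_nonneg _ _ (by positivity), ← ENNReal.rpow_mul, ← ENNReal.rpow_mul]
        ring
    _ = _ := by
        rw [← ENNReal.rpow_add_of_nonneg _ _ (by positivity) (by positivity), ← ENNReal.rpow_mul,
          ← ENNReal.rpow_mul]
        congr 2
        · rw [div_eq_mul_inv r s, hs']; field_simp
        · congr 1; ring
        · congr 1; field_simp

/-! ### Reverse Hölder weights and fractional integrals over balls. -/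

theorem volume_ball_eq {n : ℕ} (hn : 1 ≤ n) (x : Sp n) {R : ℝ} (hR : 0 < R) :
    volume (Metric.ball x R) =
      ENNReal.ofReal R ^ (n : ℝ) * volume (Metric.ball (0 : Sp n) 1) := by
  have hfr : Module.finrank ℝ (Sp n) = n := by simp
  have : Nontrivial (Sp n) := Module.nontrivial_of_finrank_pos (R := ℝ) (by omega)
  rw [Measure.addHaar_ball _ _ hR.le, hfr, ENNReal.ofReal_pow hR.le, ENNReal.rpow_natCast]

theorem prod_rpow_eq_rpow_sum {ι : Type*} {s : Finset ι} {a : ℝ≥0∞} (h0 : a ≠ 0) (ht : a ≠ ∞)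
    (e : ι → ℝ) : ∏ i ∈ s, a ^ e i = a ^ ∑ i ∈ s, e i := by
  classical
  induction s using Finset.induction_on with
  | empty => simp
  | insert i s hi ih =>
    rw [Finset.prod_insert hi, Finset.sum_insert hi, ih, ENNReal.rpow_add _ _ h0 ht]

theorem toReal_inv_eq_one_sub {p q : ℝ≥0∞} [ENNReal.HolderConjugate p q] :
    q⁻¹.toReal = 1 - p⁻¹.toReal := by
  have h := ENNReal.HolderConjugate.inv_add_inv_eq_one p q
  have hp : p⁻¹ ≠ ∞ := by
    intro h'; rw [h'] at h; simp at h
  have hq : q⁻¹ ≠ ∞ := by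
    intro h'; rw [h'] at h; simp at h
  have := congrArg ENNReal.toReal h
  rw [ENNReal.toReal_add hp hq, ENNReal.toReal_one] at this
  linarith

/-- The reverse Hölder inequality of order `r` for `v ^ (-q)`, as a comparison of Lebesgue norms of
`v⁻¹`. -/
theorem ReverseHolder.exists_eLpNorm_le {n : ℕ} (hn : 1 ≤ n) {r : ℝ} (hr : 1 ≤ r) {p q : ℝ≥0∞}
    [ENNReal.HolderConjugate p q] {v : Sp n → ℝ} (hv : IsWeight v)
    (hRH : 1 < p → ReverseHolder r (fun y => v y ^ (-q.toReal))) :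
    ∃ C : ℝ≥0, ∀ (x : Sp n) (R : ℝ), 0 < R →
      eLpNorm (fun y => ‖(v y)⁻¹‖ₑ) (ENNReal.ofReal r * q) (volume.restrict (Metric.ball x R)) ≤
        C * ENNReal.ofReal R ^ (n * (q⁻¹.toReal * (1 / r - 1))) *
          eLpNorm (fun y => ‖(v y)⁻¹‖ₑ) q (volume.restrict (Metric.ball x R)) := by
  have hr0 : 0 < r := by linarith
  have hp1 : 1 ≤ p := ENNReal.HolderConjugate.one_le p q
  rcases hp1.eq_or_lt with rfl | hp1
  · obtain rfl : q = ∞ := (ENNReal.HolderConjugate.eq_top_iff_eq_one q 1).2 rfl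
    -- Both norms are essential suprema over the same ball and the power of `R` is zero.
    refine ⟨1, fun x R hR => ?_⟩
    rw [ENNReal.mul_top (by simpa using hr0)]
    simp
  obtain ⟨-, C, hC⟩ := hRH hp1
  have hq0 : q ≠ 0 := ENNReal.HolderConjugate.ne_zero q p
  have hqt : q ≠ ∞ := fun h => hp1.ne' ((ENNReal.HolderConjugate.eq_top_iff_eq_one q p).1 h)
  have hrq0 : ENNReal.ofReal r * q ≠ 0 := mul_ne_zero (by simpa using hr0) hq0
  have hrqt : ENNReal.ofReal r * q ≠ ∞ := ENNReal.mul_ne_top ENNReal.ofReal_ne_top hqt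
  have hQ0 : 0 < q.toReal := ENNReal.toReal_pos hq0 hqt
  set Q := q.toReal with hQ
  set ω := volume (Metric.ball (0 : Sp n) 1) with hω
  have hω0 : ω ≠ 0 := (Metric.measure_ball_pos _ _ one_pos).ne'
  have hωt : ω ≠ ∞ := measure_ball_lt_top.ne
  have hfin : (ω ^ (1 / r - 1) : ℝ≥0∞) ^ (1 / Q) ≠ ∞ :=
    ENNReal.rpow_ne_top_of_nonneg (by positivity) (ENNReal.rpow_ne_top_of_ne_zero hω0 hωt)
  refine ⟨C ^ (1 / Q) * ((ω ^ (1 / r - 1) : ℝ≥0∞) ^ (1 / Q)).toNNReal, fun x R hR => ?_⟩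
  rw [eLpNorm_eq_lintegral_rpow_enorm_toReal hq0 hqt,
    eLpNorm_eq_lintegral_rpow_enorm_toReal hrq0 hrqt, ENNReal.toReal_mul,
    ENNReal.toReal_ofReal hr0.le, ← hQ]
  simp only [enorm_eq_self]
  have hae : ∀ᵐ y ∂(volume.restrict (Metric.ball x R)),
      ENNReal.ofReal (v y ^ (-Q)) = ‖(v y)⁻¹‖ₑ ^ Q := by
    refine ae_restrict_of_ae ?_
    filter_upwards [hv.2] with y hy
    rw [Real.enorm_of_nonneg (inv_nonneg.2 hy.le), ENNReal.ofReal_rpow_of_nonneg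
      (inv_nonneg.2 hy.le) hQ0.le, Real.rpow_neg hy.le, Real.inv_rpow hy.le]
  have h := hC x R hR
  rw [setLAverage_eq, setLAverage_eq, lintegral_congr_ae hae,
    lintegral_congr_ae (hae.mono fun y hy => by rw [hy, ← ENNReal.rpow_mul, mul_comm Q r])] at h
  set V := volume (Metric.ball x R) with hV
  have hV0 : V ≠ 0 := (Metric.measure_ball_pos _ _ hR).ne'
  have hVt : V ≠ ∞ := measure_ball_lt_top.ne
  set J := ∫⁻ y in Metric.ball x R, ‖(v y)⁻¹‖ₑ ^ (r * Q)
  set J' := ∫⁻ y in Metric.ball x R, ‖(v y)⁻¹‖ₑ ^ Q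
  have hR0 : ENNReal.ofReal R ≠ 0 := by simpa using hR
  have h1 : J ^ (1 / r) ≤ C * V ^ (1 / r - 1) * J' := by
    calc J ^ (1 / r) = V ^ (1 / r) * (J / V) ^ (1 / r) := by
          rw [ENNReal.div_rpow_of_nonneg _ _ (by positivity), ENNReal.mul_div_cancel]
          · simp [hV0, hVt]
          · exact ENNReal.rpow_ne_top_of_nonneg (by positivity) hVt
      _ ≤ V ^ (1 / r) * (C * (J' / V)) := by gcongr
      _ = _ := by
          rw [ENNReal.rpow_sub _ _ hV0 hVt, ENNReal.rpow_one]
          simp only [div_eq_mul_inv]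
          ring_nf
  calc J ^ (1 / (r * Q)) = (J ^ (1 / r)) ^ (1 / Q) := by
        rw [← ENNReal.rpow_mul]; congr 1; field_simp
    _ ≤ (C * V ^ (1 / r - 1) * J') ^ (1 / Q) := by gcongr
    _ = _ := by
        rw [ENNReal.mul_rpow_of_nonneg _ _ (by positivity),
          ENNReal.mul_rpow_of_nonneg _ _ (by positivity), hV, volume_ball_eq hn x hR, ← hω,
          ENNReal.mul_rpow_of_ne_top (by finiteness) hωt,
          ENNReal.mul_rpow_of_nonneg _ _ (by positivity), ENNReal.coe_mul,
          ENNReal.coe_toNNReal hfin, ENNReal.coe_rpow_of_nonneg _ (by positivity),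
          ← ENNReal.rpow_mul, ← ENNReal.rpow_mul, ENNReal.toReal_inv, ← hQ]
        have : (n : ℝ) * (Q⁻¹ * (1 / r - 1)) = n * (1 / r - 1) * (1 / Q) := by ring
        rw [this]
        ring

/-- The `L^m` norm over a ball of a fractional integral of a function supported in the concentric ball
of five times its radius. -/
theorem exists_lintegral_ball_rpow_lintegral_le {n : ℕ} (hn : 1 ≤ n) {r : ℝ} (hr : 1 ≤ r)
    {p q : ℝ≥0∞} [ENNReal.HolderConjugate p q] {v : Sp n → ℝ} (hv : IsWeight v)
    (hRH : 1 < p → ReverseHolder r (fun y => v y ^ (-q.toReal))) {lam : ℝ} (hlam0 : 0 ≤ lam)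
    (hlam : lam < n * (1 - (1 - 1 / r) * p⁻¹.toReal)) :
    ∃ C : ℝ≥0, ∀ (x₀ : Sp n) (R : ℝ), 0 < R → ∀ F : Sp n → ℝ≥0∞, AEMeasurable F →
      ∫⁻ x in Metric.ball x₀ R, (∫⁻ y in Metric.ball x₀ (5 * R),
          ‖x - y‖ₑ ^ (-lam) * (F y * ‖(v y)⁻¹‖ₑ)) ^ r ≤
        C * ENNReal.ofReal R ^ (n - r * lam) * (eLpNorm F p volume *
          eLpNorm (fun y => ‖(v y)⁻¹‖ₑ) q (volume.restrict (Metric.ball x₀ (5 * R)))) ^ r := by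
  have hr0 : 0 < r := by linarith
  have hn0 : (0 : ℝ) < n := by exact_mod_cast hn
  set θ := p⁻¹.toReal with hθ
  have hθ0 : 0 ≤ θ := ENNReal.toReal_nonneg
  have hq : q⁻¹.toReal = 1 - θ := toReal_inv_eq_one_sub
  have hθ1 : 0 ≤ 1 - θ := hq ▸ ENNReal.toReal_nonneg
  -- The Young exponent. The upper bound on `lam` says exactly that `lam * s < n`, so that the
  -- `s`-th power of the kernel is integrable on balls.
  obtain ⟨s, hs⟩ : ∃ s : ℝ, s⁻¹ = θ / r + (1 - θ) := ⟨(θ / r + (1 - θ))⁻¹, inv_inv _⟩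
  have hsinv : s⁻¹ = 1 - (1 - 1 / r) * θ := by rw [hs]; ring
  have hspos : 0 < s⁻¹ := by
    rw [hsinv]
    by_contra! h
    nlinarith
  have hs0 : 0 < s := inv_pos.1 hspos
  have hss : s * s⁻¹ = 1 := mul_inv_cancel₀ hs0.ne'
  have hlams : lam * s < n := by
    rw [← hsinv] at hlam
    calc lam * s < n * s⁻¹ * s := by gcongr
      _ = n := by field_simp
  obtain ⟨C₁, hC₁⟩ := exists_lintegral_ball_rpow_le hn (mul_nonneg hlam0 hs0.le) hlams
  obtain ⟨C₂, hC₂⟩ := ReverseHolder.exists_eLpNorm_le hn hr hv hRH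
  -- `e₁` comes from the mass of the kernel and `e₂` from the reverse Hölder inequality; the
  -- dependence on `p` cancels in the sum.
  set e₁ := (n - lam * s) * (r / s)
  set e₂ := n * ((1 - θ) * (1 / r - 1)) * r
  have he : e₁ + e₂ = n - r * lam := by
    simp only [e₁, e₂]
    rw [div_eq_mul_inv]
    have : (n - lam * s) * (r * s⁻¹) = n * r * s⁻¹ - lam * r * (s * s⁻¹) := by ring
    rw [this, hss, hs]
    field_simp; ring
  refine ⟨C₁ ^ (r / s) * C₂ ^ r * 5 ^ (e₁ + e₂), fun x₀ R hR F hF => ?_⟩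
  have hR5 : 0 < 5 * R := by linarith
  have hvm : AEMeasurable (fun y => ‖(v y)⁻¹‖ₑ) :=
    hv.1.aestronglyMeasurable.aemeasurable.inv.enorm
  have hsub : Metric.ball x₀ R ⊆ Metric.ball x₀ (5 * R) := Metric.ball_subset_ball (by linarith)
  have key := lintegral_rpow_lintegral_mul_mul_le (μ := volume.restrict (Metric.ball x₀ R))
    (ν := volume.restrict (Metric.ball x₀ (5 * R))) (k := fun x y => ‖x - y‖ₑ ^ (-lam))
    (by unfold Function.uncurry; fun_prop) (hF.restrict (s := Metric.ball x₀ (5 * R)))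
    (hvm.restrict (s := Metric.ball x₀ (5 * R))) (p := p) (q := q) hr hs
    (κ := C₁ * ENNReal.ofReal (5 * R) ^ (n - lam * s))
    (by
      intro x
      simp_rw [← ENNReal.rpow_mul, neg_mul, enorm_sub_rev x]
      exact hC₁ x₀ x _ hR5)
    (by
      intro y
      simp_rw [← ENNReal.rpow_mul, neg_mul]
      exact (lintegral_mono_set hsub).trans (hC₁ x₀ y _ hR5))
  refine key.trans ?_
  have h2 := hC₂ x₀ (5 * R) hR5
  rw [hq] at h2
  have hR0 : ENNReal.ofReal (5 * R) ≠ 0 := by simpa using hR5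
  calc _ ≤ (C₁ * ENNReal.ofReal (5 * R) ^ (n - lam * s)) ^ (r / s) *
        (eLpNorm F p volume ^ r * (C₂ * ENNReal.ofReal (5 * R) ^ (n * ((1 - θ) * (1 / r - 1))) *
          eLpNorm (fun y => ‖(v y)⁻¹‖ₑ) q (volume.restrict (Metric.ball x₀ (5 * R)))) ^ r) := by
        gcongr
        exact Measure.restrict_le_self
    _ = (C₁ ^ (r / s) * C₂ ^ r) * (ENNReal.ofReal (5 * R) ^ e₁ * ENNReal.ofReal (5 * R) ^ e₂) *
        (eLpNorm F p volume *
          eLpNorm (fun y => ‖(v y)⁻¹‖ₑ) q (volume.restrict (Metric.ball x₀ (5 * R)))) ^ r := by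
        rw [ENNReal.mul_rpow_of_nonneg _ _ (by positivity),
          ENNReal.mul_rpow_of_nonneg _ _ hr0.le, ENNReal.mul_rpow_of_nonneg _ _ hr0.le,
          ENNReal.mul_rpow_of_nonneg _ _ hr0.le, ← ENNReal.rpow_mul, ← ENNReal.rpow_mul]
        ring
    _ = _ := by
        rw [← ENNReal.rpow_add _ _ hR0 ENNReal.ofReal_ne_top, he,
          ENNReal.ofReal_mul (by norm_num), ENNReal.mul_rpow_of_ne_top (by simp) (by simp)]
        rw [ENNReal.coe_mul, ENNReal.coe_mul, ENNReal.coe_rpow_of_nonneg _ (by positivity),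
          ENNReal.coe_rpow_of_nonneg _ hr0.le, ENNReal.coe_rpow_of_ne_zero (by norm_num)]
        norm_num
        ring

/-- Admissible exponents for splitting the multilinear kernel into a product. -/
theorem exists_split_exponents {n m : ℕ} (hn : 1 ≤ n) (hm : 1 ≤ m) {a : ℝ} (ha : 0 < a)
    (ham : a < m * n) {θ : Fin m → ℝ} (hθ0 : ∀ i, 0 ≤ θ i) (hθ1 : ∀ i, θ i ≤ 1)
    (hθ : n * ∑ i, θ i < a) :
    ∃ lam : Fin m → ℝ, (∀ i, 0 < lam i ∧ lam i < n * (1 - (1 - 1 / (m : ℝ)) * θ i)) ∧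
      ∑ i, lam i = m * n - a := by
  have hn0 : (0 : ℝ) < n := by exact_mod_cast hn
  have hm1 : (1 : ℝ) ≤ m := by exact_mod_cast hm
  have hm0 : (0 : ℝ) < m := by linarith
  have h0 : 0 ≤ 1 - 1 / (m : ℝ) := by rw [sub_nonneg, div_le_one hm0]; exact hm1
  have h1 : 1 - 1 / (m : ℝ) < 1 := by have : 0 < 1 / (m : ℝ) := by positivity
                                      linarith
  set M : Fin m → ℝ := fun i => n * (1 - (1 - 1 / (m : ℝ)) * θ i)
  have hM : ∀ i, 0 < M i := by
    intro i
    have : (1 - 1 / (m : ℝ)) * θ i < 1 := by nlinarith [hθ0 i, hθ1 i]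
    exact mul_pos hn0 (by linarith)
  have hsum : ∑ i, M i = m * n - (1 - 1 / (m : ℝ)) * (n * ∑ i, θ i) := by
    simp only [M]
    rw [← Finset.mul_sum, Finset.sum_sub_distrib, ← Finset.mul_sum]
    simp
    ring
  have hθs : 0 ≤ n * ∑ i, θ i := mul_nonneg hn0.le (Finset.sum_nonneg fun i _ => hθ0 i)
  -- The upper bounds `M i` leave room for the prescribed sum because `(1 - 1/m) n ∑ θ i ≤ n ∑ θ i <
  -- a`. The exponents are then taken proportional to `M i`.
  have hlt : m * n - a < ∑ i, M i := by rw [hsum]; nlinarith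
  have hpos : 0 < ∑ i, M i := by linarith
  have ht0 : 0 < (m * n - a) / ∑ i, M i := div_pos (by linarith) hpos
  have ht1 : (m * n - a) / ∑ i, M i < 1 := (div_lt_one hpos).2 hlt
  refine ⟨fun i => (m * n - a) / (∑ i, M i) * M i, fun i => ⟨mul_pos ht0 (hM i), ?_⟩, ?_⟩
  · calc _ < 1 * M i := mul_lt_mul_of_pos_right ht1 (hM i)
      _ = M i := one_mul _
  · rw [← Finset.mul_sum]; field_simp

/-- The local estimate: the integral over a ball of a product of fractional integrals. -/
theorem exists_lintegral_ball_prod_le {n m : ℕ} (hn : 1 ≤ n) (hm : 1 ≤ m) {p q : Fin m → ℝ≥0∞}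
    [∀ i, ENNReal.HolderConjugate (p i) (q i)] {v : Fin m → Sp n → ℝ} (hv : ∀ i, IsWeight (v i))
    (hRH : ∀ i, 1 < p i → ReverseHolder m (fun y => v i y ^ (-(q i).toReal)))
    {lam : Fin m → ℝ} (hlam : ∀ i, 0 < lam i ∧
      lam i < n * (1 - (1 - 1 / (m : ℝ)) * (p i)⁻¹.toReal)) :
    ∃ C : ℝ≥0, ∀ (x₀ : Sp n) (R : ℝ), 0 < R → ∀ F : Fin m → Sp n → ℝ≥0∞,
      (∀ i, AEMeasurable (F i)) →
      ∫⁻ x in Metric.ball x₀ R, ∏ i, ∫⁻ y in Metric.ball x₀ (5 * R),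
          ‖x - y‖ₑ ^ (-lam i) * (F i y * ‖(v i y)⁻¹‖ₑ) ≤
        C * ENNReal.ofReal R ^ (n - ∑ i, lam i) * ∏ i, (eLpNorm (F i) (p i) volume *
          eLpNorm (fun y => ‖(v i y)⁻¹‖ₑ) (q i)
            (volume.restrict (Metric.ball x₀ (5 * R)))) := by
  have hm1 : (1 : ℝ) ≤ m := by exact_mod_cast hm
  have hm0 : (0 : ℝ) < m := by linarith
  choose C hC using fun i => exists_lintegral_ball_rpow_lintegral_le hn hm1 (hv i) (hRH i)
    (hlam i).1.le (hlam i).2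
  refine ⟨∏ i, C i ^ (1 / (m : ℝ)), fun x₀ R hR F hF => ?_⟩
  have hR0 : ENNReal.ofReal R ≠ 0 := by simpa using hR
  set I : Fin m → Sp n → ℝ≥0∞ := fun i x => ∫⁻ y in Metric.ball x₀ (5 * R),
    ‖x - y‖ₑ ^ (-lam i) * (F i y * ‖(v i y)⁻¹‖ₑ) with hI
  have hIm : ∀ i, AEMeasurable (I i) (volume.restrict (Metric.ball x₀ R)) := by
    intro i
    have hvm : AEMeasurable (fun y => ‖(v i y)⁻¹‖ₑ) :=
      (hv i).1.aestronglyMeasurable.aemeasurable.inv.enorm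
    have hk : Measurable fun z : Sp n × Sp n => ‖z.1 - z.2‖ₑ ^ (-lam i) := by fun_prop
    exact (hk.aemeasurable.mul (((hF i).mul hvm).restrict.comp_quasiMeasurePreserving
      Measure.quasiMeasurePreserving_snd)).lintegral_prod_right'
  -- Hölder with all `m` exponents equal to `m`, which is why the reverse Hölder order is `m`.
  have hH := ENNReal.lintegral_prod_norm_pow_le (μ := volume.restrict (Metric.ball x₀ R))
    Finset.univ (f := fun i x => I i x ^ (m : ℝ)) (fun i _ => (hIm i).pow_const _)
    (p := fun _ => 1 / (m : ℝ)) (by simp; field_simp) (fun _ _ => by positivity)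
  have hroot : ∀ a : ℝ≥0∞, (a ^ (m : ℝ)) ^ (1 / (m : ℝ)) = a := by
    intro a
    rw [← ENNReal.rpow_mul, mul_one_div_cancel hm0.ne', ENNReal.rpow_one]
  simp only [hroot] at hH
  refine hH.trans ?_
  have hexp : ∏ i, ENNReal.ofReal R ^ ((n - m * lam i) * (1 / (m : ℝ))) =
      ENNReal.ofReal R ^ (n - ∑ i, lam i) := by
    rw [prod_rpow_eq_rpow_sum hR0 ENNReal.ofReal_ne_top]
    congr 1
    have : ∀ i, (n - m * lam i) * (1 / (m : ℝ)) = n / m - lam i := by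
      intro i; field_simp
    simp_rw [this, Finset.sum_sub_distrib]
    simp; field_simp
  calc ∏ i, (∫⁻ x in Metric.ball x₀ R, I i x ^ (m : ℝ)) ^ (1 / (m : ℝ))
      ≤ ∏ i, (C i * ENNReal.ofReal R ^ (n - m * lam i) * (eLpNorm (F i) (p i) volume *
          eLpNorm (fun y => ‖(v i y)⁻¹‖ₑ) (q i)
            (volume.restrict (Metric.ball x₀ (5 * R)))) ^ (m : ℝ)) ^ (1 / (m : ℝ)) := by
        gcongr with i
        exact hC i x₀ R hR (F i) (hF i)
    _ = _ := by
        rw [← hexp, ENNReal.ofNNReal_finsetProd, ← Finset.prod_mul_distrib, ← Finset.prod_mul_distrib]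
        refine Finset.prod_congr rfl fun i _ => ?_
        rw [ENNReal.mul_rpow_of_nonneg _ _ (by positivity),
          ENNReal.mul_rpow_of_nonneg _ _ (by positivity), hroot,
          ENNReal.coe_rpow_of_nonneg _ (by positivity), ← ENNReal.rpow_mul]

/-! ### The factors of the class `ℍ_m`. -/

/-- The `i`-th factor in the definition of `HClass`. -/
def weightFactor {n : ℕ} (v : Sp n → ℝ) (q : ℝ≥0∞) (e : ℝ) (x : Sp n) (R : ℝ) : ℝ≥0∞ :=
  eLpNorm (fun y => (v y)⁻¹ /
    (volume.real (Metric.ball x R) ^ (1 / (n : ℝ)) + ‖x - y‖) ^ e) q volume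

theorem exists_volume_real_ball_rpow {n : ℕ} (hn : 1 ≤ n) :
    ∃ c : ℝ, 0 < c ∧ ∀ (x : Sp n) (R : ℝ), 0 < R →
      volume.real (Metric.ball x R) ^ (1 / (n : ℝ)) = c * R := by
  have hn0 : (0 : ℝ) < n := by exact_mod_cast hn
  have hω : 0 < volume.real (Metric.ball (0 : Sp n) 1) :=
    ENNReal.toReal_pos (Metric.measure_ball_pos _ _ one_pos).ne' measure_ball_lt_top.ne
  refine ⟨volume.real (Metric.ball (0 : Sp n) 1) ^ (1 / (n : ℝ)), by positivity, fun x R hR => ?_⟩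
  have : volume.real (Metric.ball x R) = R ^ (n : ℝ) * volume.real (Metric.ball (0 : Sp n) 1) := by
    rw [measureReal_def, volume_ball_eq hn x hR, ENNReal.toReal_mul, ← ENNReal.toReal_rpow,
      ENNReal.toReal_ofReal hR.le, measureReal_def]
  rw [this, Real.mul_rpow (by positivity) hω.le, ← Real.rpow_mul hR.le,
    mul_one_div_cancel hn0.ne', Real.rpow_one, mul_comm]

theorem IsWeight.aestronglyMeasurable_of_smul {n : ℕ} {𝕜 : Type*} [RCLike 𝕜] {v : Sp n → ℝ}
    (hv : IsWeight v) {f : Sp n → 𝕜} (hf : AEStronglyMeasurable (fun y => v y • f y)) :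
    AEStronglyMeasurable f := by
  refine (hv.1.aestronglyMeasurable.aemeasurable.inv.aestronglyMeasurable.smul hf).congr ?_
  filter_upwards [hv.2] with y hy
  simp [smul_smul, inv_mul_cancel₀ hy.ne']

/-- Hölder's inequality against the weight factor. -/
theorem lintegral_enorm_mul_le_weightFactor {n : ℕ} {𝕜 : Type*} [RCLike 𝕜] {p q : ℝ≥0∞}
    [ENNReal.HolderConjugate p q] {v : Sp n → ℝ} (hv : IsWeight v) {f : Sp n → 𝕜}
    (hf : AEStronglyMeasurable (fun y => v y • f y)) (e : ℝ) (x : Sp n) (R : ℝ) :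
    ∫⁻ y, ‖f y‖ₑ * ENNReal.ofReal
        ((volume.real (Metric.ball x R) ^ (1 / (n : ℝ)) + ‖x - y‖) ^ (-e)) ≤
      eLpNorm (fun y => v y • f y) p volume * weightFactor v q e x R := by
  set ρ : Sp n → ℝ := fun y => volume.real (Metric.ball x R) ^ (1 / (n : ℝ)) + ‖x - y‖
  have hρ : ∀ y, 0 ≤ ρ y := fun y => by positivity
  have hm : AEStronglyMeasurable (fun y => (v y)⁻¹ / ρ y ^ e) :=
    (hv.1.aestronglyMeasurable.aemeasurable.inv.div
      (by fun_prop : AEMeasurable fun y => ρ y ^ e)).aestronglyMeasurable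
  have h := eLpNorm_smul_le_mul_eLpNorm (μ := (volume : Measure (Sp n))) (p := q) (q := p) (r := 1)
    hf hm
  rw [eLpNorm_one_eq_lintegral_enorm, mul_comm] at h
  refine le_trans (le_of_eq (lintegral_congr_ae ?_)) h
  filter_upwards [hv.2] with y hy
  simp only [Pi.smul_apply', enorm_smul]
  rw [Real.enorm_of_nonneg (div_nonneg (inv_nonneg.2 hy.le) (by have := hρ y; positivity)),
    Real.enorm_of_nonneg hy.le, ← mul_assoc, ← ENNReal.ofReal_mul
    (div_nonneg (inv_nonneg.2 hy.le) (by have := hρ y; positivity)), mul_comm, Real.rpow_neg (hρ y)]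
  congr 2
  field_simp

/-- The dual weight on a dilated ball is controlled by the weight factor. -/
theorem eLpNorm_restrict_ball_le_weightFactor {n : ℕ} {q : ℝ≥0∞} {v : Sp n → ℝ} {c : ℝ}
    (hc : 0 < c) {e : ℝ} (he : 0 ≤ e) {x : Sp n} {R : ℝ} (hR : 0 < R)
    (hvol : volume.real (Metric.ball x R) ^ (1 / (n : ℝ)) = c * R) :
    eLpNorm (fun y => ‖(v y)⁻¹‖ₑ) q (volume.restrict (Metric.ball x (5 * R))) ≤
      ENNReal.ofReal ((c + 5) * R) ^ e * weightFactor v q e x R := by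
  have hpos : 0 < (c + 5) * R := by positivity
  -- On the dilated ball the base of the denominator, `c R + |x - y|`, is below `(c + 5) R`.
  set A : ℝ≥0 := (((c + 5) * R) ^ e).toNNReal with hA
  have hAe : (A : ℝ≥0∞) = ENNReal.ofReal ((c + 5) * R) ^ e := by
    rw [ENNReal.ofReal_rpow_of_pos hpos]; rfl
  have h : eLpNorm (fun y => (v y)⁻¹) q (volume.restrict (Metric.ball x (5 * R))) ≤
      A • eLpNorm (fun y => (v y)⁻¹ /
        (volume.real (Metric.ball x R) ^ (1 / (n : ℝ)) + ‖x - y‖) ^ e) q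
          (volume.restrict (Metric.ball x (5 * R))) := by
    refine eLpNorm_le_nnreal_smul_eLpNorm_of_ae_le_mul ?_ q
    filter_upwards [self_mem_ae_restrict measurableSet_ball] with y hy
    rw [← NNReal.coe_le_coe, NNReal.coe_mul, coe_nnnorm, coe_nnnorm, hvol, hA,
      Real.coe_toNNReal _ (by positivity)]
    have hy' : ‖x - y‖ < 5 * R := by rwa [Metric.mem_ball, dist_comm, dist_eq_norm] at hy
    have hρ : 0 < c * R + ‖x - y‖ := by positivity
    rw [norm_div, Real.norm_of_nonneg (by positivity : 0 ≤ (c * R + ‖x - y‖) ^ e), mul_div_assoc',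
      le_div_iff₀ (by positivity), mul_comm]
    gcongr
    linarith
  have e1 : eLpNorm (fun y => ‖(v y)⁻¹‖ₑ) q (volume.restrict (Metric.ball x (5 * R))) =
      eLpNorm (fun y => (v y)⁻¹) q (volume.restrict (Metric.ball x (5 * R))) := eLpNorm_enorm _
  rw [e1]
  refine h.trans ?_
  rw [ENNReal.smul_def, smul_eq_mul, hAe]
  gcongr
  exact eLpNorm_mono_measure _ Measure.restrict_le_self

/-! ### Pointwise bounds for the commutator integrands. -/

theorem enorm_prod_eq {ι : Type*} [Fintype ι] {𝕜 : Type*} [RCLike 𝕜] (g : ι → 𝕜) :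
    ‖∏ i, g i‖ₑ = ∏ i, ‖g i‖ₑ := by
  simp_rw [← ofReal_norm]
  rw [norm_prod, ENNReal.ofReal_prod_of_nonneg fun i _ => norm_nonneg _]

/-- The arithmetic behind the smoothness estimate. -/
theorem add_smooth_terms_le {A B D δ γ e R S : ℝ} (hB : 0 ≤ B) (hD : 0 ≤ D)
    (hδγ : δ ≤ γ) (hR : 0 < R) (hRS : 2 * R ≤ S) :
    D * (2 * R) ^ δ * (A / S ^ e) + D * (2 * S) ^ δ * (B * (2 * R) ^ γ / S ^ (e + γ)) ≤
      D * (2 ^ δ * (A + 2 ^ δ * B)) * R ^ δ * S ^ (-e) := by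
  have hS : 0 < S := by linarith
  have h3 : (2 * R) ^ γ ≤ (2 * R) ^ δ * S ^ (γ - δ) := by
    calc (2 * R) ^ γ = (2 * R) ^ δ * (2 * R) ^ (γ - δ) := by
          rw [← Real.rpow_add (by linarith)]; congr 1; ring
      _ ≤ _ := mul_le_mul_of_nonneg_left
          (Real.rpow_le_rpow (by linarith) hRS (by linarith)) (by positivity)
  have h4 : S ^ δ * S ^ (γ - δ) / S ^ (e + γ) = S ^ (-e) := by
    rw [← Real.rpow_add hS, ← Real.rpow_sub hS]; congr 1; ring
  calc _ ≤ D * (2 * R) ^ δ * (A / S ^ e) +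
        D * (2 * S) ^ δ * (B * ((2 * R) ^ δ * S ^ (γ - δ)) / S ^ (e + γ)) := by gcongr
    _ = D * (2 ^ δ * R ^ δ) * (A * S ^ (-e)) +
        D * 2 ^ δ * (B * (2 ^ δ * R ^ δ)) * (S ^ δ * S ^ (γ - δ) / S ^ (e + γ)) := by
        rw [Real.mul_rpow (by norm_num) hR.le, Real.mul_rpow (by norm_num) hS.le,
          Real.rpow_neg hS.le]
        ring
    _ = _ := by rw [h4]; ring

section Pointwise

variable {n m : ℕ} {𝕜 : Type*} [RCLike 𝕜] {α γ δ A B D : ℝ} {K : Sp n → (Fin m → Sp n) → 𝕜}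
  {b : Fin m → Sp n → 𝕜}

/-- Size of a commutator integrand. -/
theorem enorm_commIntegrand_le (hA : 0 ≤ A) (hD : 0 ≤ D)
    (hK : ∀ (x : Sp n) (y : Fin m → Sp n), 0 < ∑ i, ‖x - y i‖ →
      ‖K x y‖ ≤ A / (∑ i, ‖x - y i‖) ^ (m * n - α))
    (hb : ∀ j x y, ‖b j x - b j y‖ ≤ D * ‖x - y‖ ^ δ) (hδ : 0 ≤ δ)
    {lam : Fin m → ℝ} (hlam : ∀ i, 0 ≤ lam i) (hsum : ∑ i, lam i = m * n - (α + δ))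
    (f : Fin m → Sp n → 𝕜) (j : Fin m) (x : Sp n) (y : Fin m → Sp n) :
    ‖commIntegrand K b f j x y‖ₑ ≤
      ENNReal.ofReal (D * A) * ∏ i, (‖x - y i‖ₑ ^ (-lam i) * ‖f i (y i)‖ₑ) := by
  set S := ∑ i, ‖x - y i‖ with hS
  have hle : ∀ i, ‖x - y i‖ ≤ S := fun i =>
    Finset.single_le_sum (f := fun i => ‖x - y i‖) (fun i _ => norm_nonneg _) (Finset.mem_univ i)
  -- On the diagonal the size condition says nothing about `K`, but there `y j = x` and the factor
  -- `b j x - b j (y j)` vanishes.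
  rcases (Finset.sum_nonneg fun i _ => norm_nonneg _ : 0 ≤ S).eq_or_lt with h0 | hpos
  · have : x - y j = 0 := norm_le_zero_iff.1 (h0 ▸ hle j)
    rw [commIntegrand, ← sub_eq_zero.1 this]
    simp
  rw [Finset.prod_mul_distrib, commIntegrand, enorm_mul, enorm_prod_eq, ← mul_assoc]
  gcongr
  have h1 : ‖(b j x - b j (y j)) * K x y‖ ≤ D * A * S ^ (-∑ i, lam i) := by
    rw [norm_mul]
    calc _ ≤ (D * S ^ δ) * (A / S ^ (m * n - α)) := by
          gcongr
          · exact (hb j x (y j)).trans (by gcongr; exact hle j)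
          · exact hK x y hpos
      _ = D * A * (S ^ δ / S ^ (m * n - α)) := by ring
      _ = _ := by rw [← Real.rpow_sub hpos, hsum]; congr 2; ring
  rw [← ofReal_norm]
  refine (ENNReal.ofReal_le_ofReal h1).trans ?_
  rw [ENNReal.ofReal_mul (by positivity), ← ENNReal.ofReal_rpow_of_pos hpos]
  gcongr
  -- Distribute the power of `S` over the indices; each `S ^ (-lam i)` is at most `‖x - y i‖ ^ (-lam
  -- i)`.
  rw [← Finset.sum_neg_distrib,
    ← prod_rpow_eq_rpow_sum (by simpa using hpos) ENNReal.ofReal_ne_top]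
  refine Finset.prod_le_prod' fun i _ => ?_
  rw [ENNReal.rpow_neg, ENNReal.rpow_neg, ENNReal.inv_le_inv, ← ofReal_norm]
  exact ENNReal.rpow_le_rpow (ENNReal.ofReal_le_ofReal (hle i)) (hlam i)

/-- Size of a difference of commutator integrands away from the diagonal. -/
theorem enorm_commIntegrand_sub_le (hA : 0 ≤ A) (hB : 0 ≤ B) (hD : 0 ≤ D)
    (hK : ∀ (x : Sp n) (y : Fin m → Sp n), 0 < ∑ i, ‖x - y i‖ →
      ‖K x y‖ ≤ A / (∑ i, ‖x - y i‖) ^ (m * n - α))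
    (hK' : ∀ (x x' : Sp n) (y : Fin m → Sp n), (∃ i, 2 * ‖x - x'‖ < ‖x - y i‖) →
      ‖K x y - K x' y‖ ≤ B * ‖x - x'‖ ^ γ / (∑ i, ‖x - y i‖) ^ (m * n - α + γ))
    (hb : ∀ j x y, ‖b j x - b j y‖ ≤ D * ‖x - y‖ ^ δ) (hδ : 0 ≤ δ) (hδγ : δ ≤ γ)
    {e : Fin m → ℝ} (he : ∀ i, 0 ≤ e i) (hsum : ∑ i, e i = m * n - α) {c : ℝ} (hc : 0 < c)
    (f : Fin m → Sp n → 𝕜) (j : Fin m) {x₀ x z : Sp n} {R : ℝ}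
    (hx : x ∈ Metric.ball x₀ R) (hz : z ∈ Metric.ball x₀ R) {y : Fin m → Sp n} {i₀ : Fin m}
    (hy : y i₀ ∉ Metric.ball x₀ (5 * R)) :
    ‖commIntegrand K b f j x y - commIntegrand K b f j z y‖ₑ ≤
      ENNReal.ofReal (D * (2 ^ δ * (A + 2 ^ δ * B)) * (c + 2) ^ (m * n - α) * R ^ δ) *
        ∏ i, (‖f i (y i)‖ₑ * ENNReal.ofReal ((c * R + ‖x₀ - y i‖) ^ (-e i))) := by
  have hR : 0 < R := (dist_nonneg.trans_lt hx)
  rw [Metric.mem_ball, dist_eq_norm] at hx hz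
  rw [Metric.mem_ball, not_lt, dist_eq_norm] at hy
  have hxz : ‖x - z‖ ≤ 2 * R := by
    calc ‖x - z‖ = ‖(x - x₀) - (z - x₀)‖ := by congr 1; abel
      _ ≤ ‖x - x₀‖ + ‖z - x₀‖ := norm_sub_le _ _
      _ ≤ _ := by linarith
  set S := ∑ i, ‖x - y i‖ with hS
  have hle : ∀ i, ‖x - y i‖ ≤ S := fun i =>
    Finset.single_le_sum (f := fun i => ‖x - y i‖) (fun i _ => norm_nonneg _) (Finset.mem_univ i)
  -- The dilation factor `5` is chosen for this: one variable then has distance more than `4R ≥ 2‖x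
  -- - z‖` from `x`, so the smoothness condition applies.
  have hfar : 4 * R < ‖x - y i₀‖ := by
    have : ‖y i₀ - x₀‖ ≤ ‖x - y i₀‖ + ‖x - x₀‖ := by
      calc ‖y i₀ - x₀‖ = ‖(x - x₀) - (x - y i₀)‖ := by congr 1; abel
        _ ≤ ‖x - x₀‖ + ‖x - y i₀‖ := norm_sub_le _ _
        _ = _ := add_comm _ _
    linarith
  have hSR : 4 * R < S := hfar.trans_le (hle i₀)
  have hSpos : 0 < S := by linarith
  have hzj : ‖z - y j‖ ≤ 2 * S := by
    calc ‖z - y j‖ = ‖(x - y j) - (x - z)‖ := by congr 1; abel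
      _ ≤ ‖x - y j‖ + ‖x - z‖ := norm_sub_le _ _
      _ ≤ _ := by have := hle j; linarith
  have hKx := hK x y hSpos
  have hKxz := hK' x z y ⟨i₀, by linarith⟩
  rw [← hS] at hKx hKxz
  clear_value S
  -- In the first term `b j` gains `R^δ`. In the second it costs `S^δ`, but the kernel gains
  -- `(R/S)^γ`; since `δ ≤ γ` and `R ≤ S`, both are of order `R^δ S^{-(mn-α)}`.
  have hdecomp : commIntegrand K b f j x y - commIntegrand K b f j z y =
      ((b j x - b j z) * K x y + (b j z - b j (y j)) * (K x y - K z y)) * ∏ i, f i (y i) := by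
    simp only [commIntegrand]; ring
  have hmain : ‖(b j x - b j z) * K x y + (b j z - b j (y j)) * (K x y - K z y)‖ ≤
      D * (2 ^ δ * (A + 2 ^ δ * B)) * R ^ δ * S ^ (-(m * n - α)) := by
    have h1 : ‖(b j x - b j z) * K x y‖ ≤ D * (2 * R) ^ δ * (A / S ^ (m * n - α)) := by
      rw [norm_mul]
      exact mul_le_mul ((hb j x z).trans (mul_le_mul_of_nonneg_left
        (Real.rpow_le_rpow (norm_nonneg _) hxz hδ) hD)) hKx (norm_nonneg _)
        (by positivity)
    have h2 : ‖(b j z - b j (y j)) * (K x y - K z y)‖ ≤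
        D * (2 * S) ^ δ * (B * (2 * R) ^ γ / S ^ (m * n - α + γ)) := by
      rw [norm_mul]
      refine mul_le_mul ((hb j z (y j)).trans (mul_le_mul_of_nonneg_left
        (Real.rpow_le_rpow (norm_nonneg _) hzj hδ) hD))
        (hKxz.trans ?_) (norm_nonneg _) (by positivity)
      exact div_le_div_of_nonneg_right (mul_le_mul_of_nonneg_left
        (Real.rpow_le_rpow (norm_nonneg _) hxz (hδ.trans hδγ)) hB) (by positivity)
    exact ((norm_add_le _ _).trans (add_le_add h1 h2)).trans
      (add_smooth_terms_le hB hD hδγ hR (by linarith))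
  have hρ : ∀ i, 0 < c * R + ‖x₀ - y i‖ := fun i => by positivity
  have hρS : ∀ i, c * R + ‖x₀ - y i‖ ≤ (c + 2) * S := by
    intro i
    have h1 : ‖x₀ - y i‖ ≤ ‖x - y i‖ + ‖x - x₀‖ := by
      calc ‖x₀ - y i‖ = ‖(x - y i) - (x - x₀)‖ := by congr 1; abel
        _ ≤ _ := norm_sub_le _ _
    have h2 := hle i
    nlinarith
  -- As `S` dominates each `c * R + ‖x₀ - y i‖` up to the factor `c + 2`, its negative power splits
  -- among the variables with exponents `e i`.
  have hprod : S ^ (-(m * n - α)) ≤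
      (c + 2) ^ (m * n - α) * ∏ i, (c * R + ‖x₀ - y i‖) ^ (-e i) := by
    have h1 : ∏ i, ((c + 2) * S) ^ (-e i) ≤ ∏ i, (c * R + ‖x₀ - y i‖) ^ (-e i) := by
      refine Finset.prod_le_prod (fun i _ => by positivity) fun i _ => ?_
      exact Real.rpow_le_rpow_of_nonpos (hρ i) (hρS i) (by have := he i; linarith)
    have h2 : ∏ i, ((c + 2) * S) ^ (-e i) = ((c + 2) * S) ^ (-(m * n - α)) := by
      rw [← Real.rpow_sum_of_pos (by positivity), Finset.sum_neg_distrib, hsum]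
    rw [h2, Real.mul_rpow (by positivity) hSpos.le] at h1
    calc S ^ (-(m * n - α)) =
          (c + 2) ^ (m * n - α) * ((c + 2) ^ (-(m * n - α)) * S ^ (-(m * n - α))) := by
          rw [← mul_assoc, ← Real.rpow_add (by positivity)]; simp
      _ ≤ _ := by gcongr
  rw [hdecomp, Finset.prod_mul_distrib, enorm_mul, enorm_prod_eq, mul_comm (∏ i, ‖f i (y i)‖ₑ),
    ← mul_assoc]
  gcongr
  rw [← ENNReal.ofReal_prod_of_nonneg (fun i _ => by have := hρ i; positivity),
    ← ENNReal.ofReal_mul (by positivity), ← ofReal_norm]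
  refine ENNReal.ofReal_le_ofReal (hmain.trans ?_)
  calc _ ≤ D * (2 ^ δ * (A + 2 ^ δ * B)) * R ^ δ *
        ((c + 2) ^ (m * n - α) * ∏ i, (c * R + ‖x₀ - y i‖) ^ (-e i)) := by gcongr
    _ = _ := by ring

end Pointwise

/-! ### Integrated local and tail estimates. -/

section Estimates

variable {n m : ℕ} {𝕜 : Type*} [RCLike 𝕜] {α γ δ A B D : ℝ} {K : Sp n → (Fin m → Sp n) → 𝕜}
  {b : Fin m → Sp n → 𝕜} {p q : Fin m → ℝ≥0∞} {v : Fin m → Sp n → ℝ} {e : Fin m → ℝ}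

/-- The cube of balls carrying the local part of the integrals. -/
abbrev localCube {n : ℕ} (m : ℕ) (x₀ : Sp n) (R : ℝ) : Set (Fin m → Sp n) :=
  Set.univ.pi fun _ => Metric.ball x₀ (5 * R)

theorem measurableSet_localCube (x₀ : Sp n) (R : ℝ) : MeasurableSet (localCube m x₀ R) :=
  MeasurableSet.univ_pi fun _ => measurableSet_ball

/-- Two families of exponents meet here: `lam`, with sum `mn - α - δ`, splits the kernel, while `e`,
with sum `mn - α`, compares the dual weights on the dilated ball with the weight factors. The
mismatch leaves `R^{n - ∑ lam + ∑ e} = R^{n+δ}`. -/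
theorem exists_lintegral_localCube_le (hn : 1 ≤ n) (hm : 1 ≤ m)
    [∀ i, ENNReal.HolderConjugate (p i) (q i)] (hA : 0 ≤ A) (hD : 0 ≤ D)
    (hK : ∀ (x : Sp n) (y : Fin m → Sp n), 0 < ∑ i, ‖x - y i‖ →
      ‖K x y‖ ≤ A / (∑ i, ‖x - y i‖) ^ (m * n - α))
    (hb : ∀ j x y, ‖b j x - b j y‖ ≤ D * ‖x - y‖ ^ δ) (hδ : 0 ≤ δ)
    (hαδ0 : 0 < α + δ) (hαδ : α + δ < m * n) (hp : n * ∑ i, (p i)⁻¹.toReal < α + δ)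
    (hv : ∀ i, IsWeight (v i))
    (hRH : ∀ i, 1 < p i → ReverseHolder m (fun y => v i y ^ (-(q i).toReal)))
    (he : ∀ i, 0 ≤ e i) (hsum : ∑ i, e i = m * n - α) :
    ∃ C : ℝ≥0, ∀ (x₀ : Sp n) (R : ℝ), 0 < R → ∀ f : Fin m → Sp n → 𝕜,
      (∀ i, AEStronglyMeasurable (fun y => v i y • f i y)) →
      ∫⁻ x in Metric.ball x₀ R, ∫⁻ y in localCube m x₀ R, ∑ j, ‖commIntegrand K b f j x y‖ₑ ≤
        C * ENNReal.ofReal R ^ (n + δ) * ((∏ i, eLpNorm (fun y => v i y • f i y) (p i) volume) *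
          ∏ i, weightFactor (v i) (q i) (e i) x₀ R) := by
  have hθ1 : ∀ i, (p i)⁻¹.toReal ≤ 1 := fun i => by
    have := toReal_inv_eq_one_sub (p := p i) (q := q i)
    have h2 : 0 ≤ (q i)⁻¹.toReal := ENNReal.toReal_nonneg
    linarith
  obtain ⟨lam, hlam, hlsum⟩ := exists_split_exponents hn hm hαδ0 hαδ
    (fun i => ENNReal.toReal_nonneg) hθ1 hp
  obtain ⟨C, hC⟩ := exists_lintegral_ball_prod_le hn hm hv hRH hlam
  obtain ⟨c, hc, hvol⟩ := exists_volume_real_ball_rpow hn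
  refine ⟨m * (D * A).toNNReal * C * (c + 5).toNNReal ^ (m * n - α), fun x₀ R hR f hf => ?_⟩
  have hfm : ∀ i, AEStronglyMeasurable (f i) := fun i => (hv i).aestronglyMeasurable_of_smul (hf i)
  have hinner : ∀ x, ∫⁻ y in localCube m x₀ R, ∑ j, ‖commIntegrand K b f j x y‖ₑ ≤
      m * ENNReal.ofReal (D * A) * ∏ i, ∫⁻ y in Metric.ball x₀ (5 * R),
        ‖x - y‖ₑ ^ (-lam i) * (‖v i y • f i y‖ₑ * ‖(v i y)⁻¹‖ₑ) := by
    intro x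
    have hmeas : ∀ i, AEMeasurable (fun y => ‖x - y‖ₑ ^ (-lam i) * ‖f i y‖ₑ)
        (volume.restrict (Metric.ball x₀ (5 * R))) := fun i =>
      ((by fun_prop : Measurable fun y : Sp n => ‖x - y‖ₑ ^ (-lam i)).aemeasurable.mul
        (hfm i).enorm).restrict
    calc _ ≤ ∫⁻ y in localCube m x₀ R, m * ENNReal.ofReal (D * A) *
          ∏ i, (‖x - y i‖ₑ ^ (-lam i) * ‖f i (y i)‖ₑ) := by
          refine lintegral_mono fun y => ?_
          refine (Finset.sum_le_sum fun j _ => enorm_commIntegrand_le hA hD hK hb hδ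
            (fun i => (hlam i).1.le) hlsum f j x y).trans_eq ?_
          simp [mul_assoc]
      _ = m * ENNReal.ofReal (D * A) * ∫⁻ y in localCube m x₀ R,
          ∏ i, (‖x - y i‖ₑ ^ (-lam i) * ‖f i (y i)‖ₑ) :=
          lintegral_const_mul' _ _ (ENNReal.mul_ne_top (by simp) ENNReal.ofReal_ne_top)
      _ = m * ENNReal.ofReal (D * A) * ∏ i, ∫⁻ y in Metric.ball x₀ (5 * R),
          ‖x - y‖ₑ ^ (-lam i) * ‖f i y‖ₑ := by
          rw [volume_pi, localCube, Measure.restrict_pi_pi]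
          rw [lintegral_fin_prod (volume.restrict (Metric.ball x₀ (5 * R)))
            (fun i y => ‖x - y‖ₑ ^ (-lam i) * ‖f i y‖ₑ) hmeas]
      _ = _ := by
          congr 1
          refine Finset.prod_congr rfl fun i _ => lintegral_congr_ae (ae_restrict_of_ae ?_)
          filter_upwards [(hv i).2] with y hy
          have h1 : ‖v i y‖ₑ * ‖(v i y)⁻¹‖ₑ = 1 := by
            rw [← enorm_mul, mul_inv_cancel₀ hy.ne', enorm_one]
          rw [enorm_smul, mul_right_comm, h1, one_mul]
  have hweight : ∏ i, eLpNorm (fun y => ‖(v i y)⁻¹‖ₑ) (q i)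
      (volume.restrict (Metric.ball x₀ (5 * R))) ≤
      ENNReal.ofReal ((c + 5) * R) ^ (m * n - α) * ∏ i, weightFactor (v i) (q i) (e i) x₀ R := by
    have hpos : 0 < (c + 5) * R := by positivity
    rw [← hsum, ← prod_rpow_eq_rpow_sum (by simpa using hpos) ENNReal.ofReal_ne_top,
      ← Finset.prod_mul_distrib]
    exact Finset.prod_le_prod' fun i _ =>
      eLpNorm_restrict_ball_le_weightFactor hc (he i) hR (hvol x₀ R hR)
  have hR0 : ENNReal.ofReal R ≠ 0 := by simpa using hR
  calc _ ≤ ∫⁻ x in Metric.ball x₀ R, m * ENNReal.ofReal (D * A) *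
        ∏ i, ∫⁻ y in Metric.ball x₀ (5 * R),
          ‖x - y‖ₑ ^ (-lam i) * (‖v i y • f i y‖ₑ * ‖(v i y)⁻¹‖ₑ) := lintegral_mono hinner
    _ = m * ENNReal.ofReal (D * A) * ∫⁻ x in Metric.ball x₀ R,
        ∏ i, ∫⁻ y in Metric.ball x₀ (5 * R),
          ‖x - y‖ₑ ^ (-lam i) * (‖v i y • f i y‖ₑ * ‖(v i y)⁻¹‖ₑ) :=
        lintegral_const_mul' _ _ (ENNReal.mul_ne_top (by simp) ENNReal.ofReal_ne_top)
    _ ≤ m * ENNReal.ofReal (D * A) * (C * ENNReal.ofReal R ^ (n - ∑ i, lam i) *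
        ∏ i, (eLpNorm (fun y => ‖v i y • f i y‖ₑ) (p i) volume *
          eLpNorm (fun y => ‖(v i y)⁻¹‖ₑ) (q i) (volume.restrict (Metric.ball x₀ (5 * R))))) := by
        gcongr
        exact hC x₀ R hR (fun i y => ‖v i y • f i y‖ₑ) fun i => (hf i).enorm
    _ ≤ m * ENNReal.ofReal (D * A) * (C * ENNReal.ofReal R ^ (n - ∑ i, lam i) *
        ((∏ i, eLpNorm (fun y => v i y • f i y) (p i) volume) *
          (ENNReal.ofReal ((c + 5) * R) ^ (m * n - α) *
            ∏ i, weightFactor (v i) (q i) (e i) x₀ R))) := by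
        rw [Finset.prod_mul_distrib]
        gcongr with i
        exact (eLpNorm_enorm _).le
    _ = _ := by
        have h1 : (n : ℝ) + δ = (n - ∑ i, lam i) + (m * n - α) := by rw [hlsum]; ring
        rw [h1, ENNReal.rpow_add _ _ hR0 ENNReal.ofReal_ne_top, ENNReal.ofReal_mul (p := c + 5) (by positivity),
          ENNReal.mul_rpow_of_ne_top (by simp) (by simp)]
        have h2 : (c + 5).toNNReal ≠ 0 := by simp; positivity
        rw [ENNReal.coe_mul, ENNReal.coe_mul, ENNReal.coe_mul, ENNReal.coe_natCast,
          ENNReal.coe_rpow_of_ne_zero h2]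
        simp only [ENNReal.ofReal]
        ring

/-- The pointwise bound is a product over the variables and depends on the ball but not on `x` and
`z`. Tonelli and Hölder against each weight factor thus give a tail bound uniform in `x` and `z`. -/
theorem exists_lintegral_compl_localCube_le (hn : 1 ≤ n)
    [∀ i, ENNReal.HolderConjugate (p i) (q i)] (hA : 0 ≤ A) (hB : 0 ≤ B) (hD : 0 ≤ D)
    (hK : ∀ (x : Sp n) (y : Fin m → Sp n), 0 < ∑ i, ‖x - y i‖ →
      ‖K x y‖ ≤ A / (∑ i, ‖x - y i‖) ^ (m * n - α))
    (hK' : ∀ (x x' : Sp n) (y : Fin m → Sp n), (∃ i, 2 * ‖x - x'‖ < ‖x - y i‖) →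
      ‖K x y - K x' y‖ ≤ B * ‖x - x'‖ ^ γ / (∑ i, ‖x - y i‖) ^ (m * n - α + γ))
    (hb : ∀ j x y, ‖b j x - b j y‖ ≤ D * ‖x - y‖ ^ δ) (hδ : 0 ≤ δ) (hδγ : δ ≤ γ)
    (hv : ∀ i, IsWeight (v i)) (he : ∀ i, 0 ≤ e i) (hsum : ∑ i, e i = m * n - α) :
    ∃ C : ℝ≥0, ∀ (x₀ : Sp n) (R : ℝ), 0 < R → ∀ f : Fin m → Sp n → 𝕜,
      (∀ i, AEStronglyMeasurable (fun y => v i y • f i y)) →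
      ∀ x ∈ Metric.ball x₀ R, ∀ z ∈ Metric.ball x₀ R, ∀ j,
      ∫⁻ y in (localCube m x₀ R)ᶜ, ‖commIntegrand K b f j x y - commIntegrand K b f j z y‖ₑ ≤
        C * ENNReal.ofReal R ^ δ * ((∏ i, eLpNorm (fun y => v i y • f i y) (p i) volume) *
          ∏ i, weightFactor (v i) (q i) (e i) x₀ R) := by
  obtain ⟨c, hc, hvol⟩ := exists_volume_real_ball_rpow hn
  set M : ℝ := D * (2 ^ δ * (A + 2 ^ δ * B)) * (c + 2) ^ (m * n - α) with hM
  have hM0 : 0 ≤ M := by positivity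
  refine ⟨M.toNNReal, fun x₀ R hR f hf x hx z hz j => ?_⟩
  have hfm : ∀ i, AEStronglyMeasurable (f i) := fun i => (hv i).aestronglyMeasurable_of_smul (hf i)
  have hpt : ∀ y ∈ (localCube m x₀ R)ᶜ,
      ‖commIntegrand K b f j x y - commIntegrand K b f j z y‖ₑ ≤ ENNReal.ofReal (M * R ^ δ) *
        ∏ i, (‖f i (y i)‖ₑ * ENNReal.ofReal ((c * R + ‖x₀ - y i‖) ^ (-e i))) := by
    intro y hy
    obtain ⟨i₀, hi₀⟩ : ∃ i₀, y i₀ ∉ Metric.ball x₀ (5 * R) := by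
      by_contra! h
      exact hy fun i _ => h i
    exact enorm_commIntegrand_sub_le hA hB hD hK hK' hb hδ hδγ he hsum hc f j hx hz hi₀
  calc _ ≤ ∫⁻ y in (localCube m x₀ R)ᶜ, ENNReal.ofReal (M * R ^ δ) *
        ∏ i, (‖f i (y i)‖ₑ * ENNReal.ofReal ((c * R + ‖x₀ - y i‖) ^ (-e i))) :=
        setLIntegral_mono' (measurableSet_localCube x₀ R).compl hpt
    _ ≤ ∫⁻ y : Fin m → Sp n, ENNReal.ofReal (M * R ^ δ) *
        ∏ i, (‖f i (y i)‖ₑ * ENNReal.ofReal ((c * R + ‖x₀ - y i‖) ^ (-e i))) :=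
        setLIntegral_le_lintegral _ _
    _ = ENNReal.ofReal (M * R ^ δ) *
        ∏ i, ∫⁻ y, ‖f i y‖ₑ * ENNReal.ofReal ((c * R + ‖x₀ - y‖) ^ (-e i)) := by
        rw [lintegral_const_mul' _ _ ENNReal.ofReal_ne_top, volume_pi,
          lintegral_fin_prod volume
            (fun i y => ‖f i y‖ₑ * ENNReal.ofReal ((c * R + ‖x₀ - y‖) ^ (-e i)))]
        exact fun i => (hfm i).enorm.mul (by fun_prop)
    _ ≤ ENNReal.ofReal (M * R ^ δ) * ∏ i, (eLpNorm (fun y => v i y • f i y) (p i) volume *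
          weightFactor (v i) (q i) (e i) x₀ R) := by
        gcongr with i
        have := lintegral_enorm_mul_le_weightFactor (p := p i) (q := q i) (hv i) (hf i) (e i) x₀ R
        rwa [hvol x₀ R hR] at this
    _ = _ := by
        rw [Finset.prod_mul_distrib, ENNReal.ofReal_mul hM0, ENNReal.ofReal_rpow_of_pos hR]
        rfl

end Estimates

/-! ### From differences of kernels to functions modulo constants and their oscillation. -/

section ModuloConstants

variable {n m : ℕ} {𝕜 : Type*} [RCLike 𝕜] {Φ : Fin m → Sp n → (Fin m → Sp n) → 𝕜}

/-- The local part of the integral of a family of kernels. -/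
def localIntegral (Φ : Fin m → Sp n → (Fin m → Sp n) → 𝕜) (x₀ : Sp n) (R : ℝ) (x : Sp n) : ℝ≥0∞ :=
  ∫⁻ y in localCube m x₀ R, ∑ j, ‖Φ j x y‖ₑ

theorem aemeasurable_localIntegral
    (hΦ : ∀ j, AEStronglyMeasurable (fun q : Sp n × (Fin m → Sp n) => Φ j q.1 q.2) volume)
    (x₀ : Sp n) (R : ℝ) : AEMeasurable (localIntegral Φ x₀ R) := by
  have h : AEMeasurable (fun q : Sp n × (Fin m → Sp n) => ∑ j, ‖Φ j q.1 q.2‖ₑ)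
      ((volume : Measure (Sp n)).prod (volume.restrict (localCube m x₀ R))) := by
    refine AEMeasurable.mono_ac ?_
      (Measure.AbsolutelyContinuous.prod Measure.AbsolutelyContinuous.rfl
        Measure.absolutelyContinuous_restrict)
    exact Finset.aemeasurable_fun_sum _ fun j _ => (hΦ j).enorm
  exact h.lintegral_prod_right'

/-- The difference of the kernels at two points of a ball is integrable, with a bound by the local parts
and the tail. -/
theorem sum_lintegral_enorm_sub_le {x₀ : Sp n} {R : ℝ} {T : ℝ≥0∞} {x z : Sp n}
    (hx : ∀ j, AEStronglyMeasurable (Φ j x)) (hz : ∀ j, AEStronglyMeasurable (Φ j z))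
    (hT : ∀ j, ∫⁻ y in (localCube m x₀ R)ᶜ, ‖Φ j x y - Φ j z y‖ₑ ≤ T) :
    ∑ j, ∫⁻ y, ‖Φ j x y - Φ j z y‖ₑ ≤
      localIntegral Φ x₀ R x + localIntegral Φ x₀ R z + m * T := by
  calc ∑ j, ∫⁻ y, ‖Φ j x y - Φ j z y‖ₑ
      ≤ ∑ j, ((∫⁻ y in localCube m x₀ R, ‖Φ j x y‖ₑ) +
          (∫⁻ y in localCube m x₀ R, ‖Φ j z y‖ₑ) + T) := by
        refine Finset.sum_le_sum fun j _ => ?_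
        rw [← lintegral_add_compl _ (measurableSet_localCube x₀ R)]
        gcongr
        · rw [← lintegral_add_left' (hx j).enorm.restrict]
          exact lintegral_mono fun y => enorm_sub_le
        · exact hT j
    _ = _ := by
        rw [localIntegral, localIntegral, lintegral_finsetSum' _ fun j _ => (hx j).enorm.restrict,
          lintegral_finsetSum' _ fun j _ => (hz j).enorm.restrict, Finset.sum_add_distrib,
          Finset.sum_add_distrib]
        simp

/-- `g` is given, modulo constants, by the integrals of the differences of the kernels. -/
def HasDifferences (Φ : Fin m → Sp n → (Fin m → Sp n) → 𝕜) (g : Sp n → 𝕜) : Prop :=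
  ∀ᵐ q : Sp n × Sp n,
    (∀ j, Integrable (fun y => Φ j q.1 y - Φ j q.2 y)) ∧
    g q.1 - g q.2 = ∑ j, ∫ y, (Φ j q.1 y - Φ j q.2 y)

variable {L T : Sp n → ℝ → ℝ≥0∞}

theorem ae_localIntegral_lt_top
    (hΦ : ∀ j, AEStronglyMeasurable (fun q : Sp n × (Fin m → Sp n) => Φ j q.1 q.2) volume)
    (hL : ∀ x₀ R, 0 < R → ∫⁻ x in Metric.ball x₀ R, localIntegral Φ x₀ R x ≤ L x₀ R)
    (hLt : ∀ x₀ R, 0 < R → L x₀ R ≠ ∞) (x₀ : Sp n) {R : ℝ} (hR : 0 < R) :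
    ∀ᵐ x, x ∈ Metric.ball x₀ R → localIntegral Φ x₀ R x < ∞ := by
  rw [← ae_restrict_iff' measurableSet_ball]
  exact ae_lt_top' (aemeasurable_localIntegral hΦ x₀ R).restrict
    (ne_top_of_le_ne_top (hLt x₀ R hR) (hL x₀ R hR))

theorem ae_aestronglyMeasurable_section
    (hΦ : ∀ j, AEStronglyMeasurable (fun q : Sp n × (Fin m → Sp n) => Φ j q.1 q.2) volume) :
    ∀ᵐ x, ∀ j, AEStronglyMeasurable (Φ j x) :=
  ae_all_iff.2 fun j => (hΦ j).prodMk_left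

/-- Almost every point is good: its local integrals over all the balls `B(0, N + 1)` containing it
are finite. Two good points share such a ball, so their difference of kernels is integrable, and
integrating the difference to a fixed good point `z₀` defines `g`. -/
theorem exists_hasDifferences
    (hΦ : ∀ j, AEStronglyMeasurable (fun q : Sp n × (Fin m → Sp n) => Φ j q.1 q.2) volume)
    (hL : ∀ x₀ R, 0 < R → ∫⁻ x in Metric.ball x₀ R, localIntegral Φ x₀ R x ≤ L x₀ R)
    (hLt : ∀ x₀ R, 0 < R → L x₀ R ≠ ∞)
    (hT : ∀ x₀ R, 0 < R → ∀ x ∈ Metric.ball x₀ R, ∀ z ∈ Metric.ball x₀ R, ∀ j,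
      ∫⁻ y in (localCube m x₀ R)ᶜ, ‖Φ j x y - Φ j z y‖ₑ ≤ T x₀ R)
    (hTt : ∀ x₀ R, 0 < R → T x₀ R ≠ ∞) : ∃ g, HasDifferences Φ g := by
  have hgood : ∀ᵐ x : Sp n, (∀ j, AEStronglyMeasurable (Φ j x)) ∧
      ∀ N : ℕ, x ∈ Metric.ball (0 : Sp n) (N + 1) → localIntegral Φ 0 (N + 1) x < ∞ := by
    filter_upwards [ae_aestronglyMeasurable_section hΦ, ae_all_iff.2 fun N : ℕ =>
      ae_localIntegral_lt_top hΦ hL hLt 0 (by positivity : (0 : ℝ) < N + 1)] with x h1 h2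
    exact ⟨h1, h2⟩
  have hint : ∀ x z : Sp n, ((∀ j, AEStronglyMeasurable (Φ j x)) ∧
      ∀ N : ℕ, x ∈ Metric.ball (0 : Sp n) (N + 1) → localIntegral Φ 0 (N + 1) x < ∞) →
      ((∀ j, AEStronglyMeasurable (Φ j z)) ∧
      ∀ N : ℕ, z ∈ Metric.ball (0 : Sp n) (N + 1) → localIntegral Φ 0 (N + 1) z < ∞) →
      ∀ j, Integrable (fun y => Φ j x y - Φ j z y) := by
    intro x z hx hz j
    obtain ⟨N, hN⟩ := exists_nat_gt (max ‖x‖ ‖z‖)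
    have hpos : (0 : ℝ) < N + 1 := by positivity
    have hxN : x ∈ Metric.ball (0 : Sp n) (N + 1) := by
      rw [mem_ball_zero_iff]; linarith [le_max_left ‖x‖ ‖z‖]
    have hzN : z ∈ Metric.ball (0 : Sp n) (N + 1) := by
      rw [mem_ball_zero_iff]; linarith [le_max_right ‖x‖ ‖z‖]
    refine ⟨(hx.1 j).sub (hz.1 j), ?_⟩
    have h := sum_lintegral_enorm_sub_le hx.1 hz.1 fun j => hT 0 (N + 1) hpos x hxN z hzN j
    refine lt_of_le_of_lt ((Finset.single_le_sum
      (f := fun j => ∫⁻ y, ‖Φ j x y - Φ j z y‖ₑ) (fun _ _ => zero_le)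
      (Finset.mem_univ j)).trans h) ?_
    exact ENNReal.add_lt_top.2 ⟨ENNReal.add_lt_top.2 ⟨hx.2 N hxN, hz.2 N hzN⟩,
      ENNReal.mul_lt_top (by simp) (hTt 0 _ hpos).lt_top⟩
  obtain ⟨z₀, hz₀⟩ := hgood.exists
  refine ⟨fun x => ∑ j, ∫ y, (Φ j x y - Φ j z₀ y), ?_⟩
  filter_upwards [Measure.quasiMeasurePreserving_fst.ae hgood,
    Measure.quasiMeasurePreserving_snd.ae hgood] with q h1 h2
  refine ⟨hint _ _ h1 h2, ?_⟩
  rw [← Finset.sum_sub_distrib]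
  refine Finset.sum_congr rfl fun j _ => ?_
  rw [← integral_sub (hint _ _ h1 hz₀ j) (hint _ _ h2 hz₀ j)]
  simp

theorem HasDifferences.ae_ae_enorm_sub_le {g : Sp n → 𝕜} (hg : HasDifferences Φ g)
    (hΦ : ∀ j, AEStronglyMeasurable (fun q : Sp n × (Fin m → Sp n) => Φ j q.1 q.2) volume)
    {x₀ : Sp n} {R : ℝ} {T : ℝ≥0∞}
    (hT : ∀ x ∈ Metric.ball x₀ R, ∀ z ∈ Metric.ball x₀ R, ∀ j,
      ∫⁻ y in (localCube m x₀ R)ᶜ, ‖Φ j x y - Φ j z y‖ₑ ≤ T) :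
    ∀ᵐ x ∂(volume.restrict (Metric.ball x₀ R)), ∀ᵐ z ∂(volume.restrict (Metric.ball x₀ R)),
      ‖g x - g z‖ₑ ≤ localIntegral Φ x₀ R x + localIntegral Φ x₀ R z + m * T := by
  have hmeas := ae_aestronglyMeasurable_section hΦ
  filter_upwards [ae_restrict_of_ae (Measure.ae_ae_of_ae_prod hg), ae_restrict_of_ae hmeas,
    self_mem_ae_restrict measurableSet_ball] with x h1 h2 hx
  filter_upwards [ae_restrict_of_ae h1, ae_restrict_of_ae hmeas,
    self_mem_ae_restrict measurableSet_ball] with z h3 h4 hz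
  rw [h3.2]
  refine (enorm_sum_le _ _).trans (le_trans (Finset.sum_le_sum fun j _ => ?_)
    (sum_lintegral_enorm_sub_le h2 h4 (hT x hx z hz)))
  exact enorm_integral_le_lintegral_enorm _

/-- Since `g` is only known through its differences, measurability has to be recovered: freezing a
typical `x` makes `g z` a constant minus a parameter integral, for almost every `z`. -/
theorem HasDifferences.aestronglyMeasurable {g : Sp n → 𝕜} (hg : HasDifferences Φ g)
    (hΦ : ∀ j, AEStronglyMeasurable (fun q : Sp n × (Fin m → Sp n) => Φ j q.1 q.2) volume) :
    AEStronglyMeasurable g := by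
  obtain ⟨x, h1, h2⟩ := ((Measure.ae_ae_of_ae_prod hg).and
    (ae_aestronglyMeasurable_section hΦ)).exists
  have h : AEStronglyMeasurable (fun z => g x - ∑ j, ∫ y, (Φ j x y - Φ j z y)) := by
    refine aestronglyMeasurable_const.sub (Finset.aestronglyMeasurable_fun_sum _ fun j _ => ?_)
    have : AEStronglyMeasurable (fun q : Sp n × (Fin m → Sp n) => Φ j x q.2 - Φ j q.1 q.2)
        (volume.prod volume) :=
      ((h2 j).comp_quasiMeasurePreserving Measure.quasiMeasurePreserving_snd).sub (hΦ j)
    exact this.integral_prod_right'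
  refine h.congr ?_
  filter_upwards [h1] with z hz
  rw [← hz.2]; abel

/-- Freeze an `x` in the ball with finite local integral; then `‖g z‖ₑ` is at most the local
integral at `z` plus a finite constant. -/
theorem HasDifferences.integrableOn_ball {g : Sp n → 𝕜} (hg : HasDifferences Φ g)
    (hΦ : ∀ j, AEStronglyMeasurable (fun q : Sp n × (Fin m → Sp n) => Φ j q.1 q.2) volume)
    (hL : ∀ x₀ R, 0 < R → ∫⁻ x in Metric.ball x₀ R, localIntegral Φ x₀ R x ≤ L x₀ R)
    (hLt : ∀ x₀ R, 0 < R → L x₀ R ≠ ∞)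
    (hT : ∀ x₀ R, 0 < R → ∀ x ∈ Metric.ball x₀ R, ∀ z ∈ Metric.ball x₀ R, ∀ j,
      ∫⁻ y in (localCube m x₀ R)ᶜ, ‖Φ j x y - Φ j z y‖ₑ ≤ T x₀ R)
    (hTt : ∀ x₀ R, 0 < R → T x₀ R ≠ ∞) (x₀ : Sp n) {R : ℝ} (hR : 0 < R) :
    IntegrableOn g (Metric.ball x₀ R) := by
  have hne : (ae (volume.restrict (Metric.ball x₀ R))).NeBot := by
    rw [ae_neBot, Ne, Measure.restrict_eq_zero]
    exact (Metric.measure_ball_pos _ _ hR).ne'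
  have hlt := ae_localIntegral_lt_top hΦ hL hLt x₀ hR
  rw [← ae_restrict_iff' measurableSet_ball] at hlt
  obtain ⟨x, h1, h2⟩ := ((hg.ae_ae_enorm_sub_le hΦ (hT x₀ R hR)).and hlt).exists
  refine ⟨(hg.aestronglyMeasurable hΦ).restrict, ?_⟩
  have hbound : ∀ᵐ z ∂(volume.restrict (Metric.ball x₀ R)),
      ‖g z‖ₑ ≤ localIntegral Φ x₀ R z + (‖g x‖ₑ + localIntegral Φ x₀ R x + m * T x₀ R) := by
    filter_upwards [h1] with z hz
    calc ‖g z‖ₑ = ‖g x - (g x - g z)‖ₑ := by congr 1; abel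
      _ ≤ ‖g x‖ₑ + ‖g x - g z‖ₑ := enorm_sub_le
      _ ≤ ‖g x‖ₑ + (localIntegral Φ x₀ R x + localIntegral Φ x₀ R z + m * T x₀ R) := by gcongr
      _ = _ := by ring
  refine (lintegral_mono_ae hbound).trans_lt ?_
  rw [lintegral_add_right _ measurable_const, setLIntegral_const]
  refine ENNReal.add_lt_top.2 ⟨(hL x₀ R hR).trans_lt (hLt x₀ R hR).lt_top,
    ENNReal.mul_lt_top ?_ measure_ball_lt_top⟩
  exact ENNReal.add_lt_top.2 ⟨ENNReal.add_lt_top.2 ⟨enorm_lt_top, h2⟩,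
      ENNReal.mul_lt_top (by simp) (hTt x₀ R hR).lt_top⟩

/-- `g x - g_B` is the average of `g x - g z` over `z ∈ B`. After integration in `x` the local part
occurs twice, once for each of `x` and `z`, and the tail constant is multiplied by `|B|`. -/
theorem HasDifferences.lintegral_ball_enorm_sub_average_le {g : Sp n → 𝕜}
    (hg : HasDifferences Φ g)
    (hΦ : ∀ j, AEStronglyMeasurable (fun q : Sp n × (Fin m → Sp n) => Φ j q.1 q.2) volume)
    {x₀ : Sp n} {R : ℝ} {L T : ℝ≥0∞} (hR : 0 < R)
    (hL : ∫⁻ x in Metric.ball x₀ R, localIntegral Φ x₀ R x ≤ L)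
    (hT : ∀ x ∈ Metric.ball x₀ R, ∀ z ∈ Metric.ball x₀ R, ∀ j,
      ∫⁻ y in (localCube m x₀ R)ᶜ, ‖Φ j x y - Φ j z y‖ₑ ≤ T)
    (hint : IntegrableOn g (Metric.ball x₀ R)) :
    ∫⁻ x in Metric.ball x₀ R, ‖g x - ⨍ z in Metric.ball x₀ R, g z‖ₑ ≤
      2 * L + m * T * volume (Metric.ball x₀ R) := by
  set V := volume (Metric.ball x₀ R) with hV
  have hV0 : V ≠ 0 := (Metric.measure_ball_pos _ _ hR).ne'
  have hVt : V ≠ ∞ := measure_ball_lt_top.ne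
  set ν : Measure (Sp n) := V⁻¹ • volume.restrict (Metric.ball x₀ R) with hν
  have hprob : IsProbabilityMeasure ν := ⟨by
    rw [hν, Measure.smul_apply, Measure.restrict_apply_univ, smul_eq_mul,
      ENNReal.inv_mul_cancel hV0 hVt]⟩
  have hgν : Integrable g ν := hint.smul_measure (ENNReal.inv_ne_top.2 hV0)
  have hpt : ∀ᵐ x ∂(volume.restrict (Metric.ball x₀ R)),
      ‖g x - ⨍ z in Metric.ball x₀ R, g z‖ₑ ≤ localIntegral Φ x₀ R x + (m * T + V⁻¹ * L) := by
    filter_upwards [hg.ae_ae_enorm_sub_le hΦ hT] with x hx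
    have hx' : ∀ᵐ z ∂ν, ‖g x - g z‖ₑ ≤
        localIntegral Φ x₀ R x + localIntegral Φ x₀ R z + m * T := Measure.ae_smul_measure hx _
    have h1 : g x - ⨍ z in Metric.ball x₀ R, g z = ∫ z, (g x - g z) ∂ν := by
      rw [setAverage_eq', integral_sub (integrable_const _) hgν]
      simp [hν, hV]
    rw [h1]
    calc _ ≤ ∫⁻ z, ‖g x - g z‖ₑ ∂ν := enorm_integral_le_lintegral_enorm _
      _ ≤ ∫⁻ z, (localIntegral Φ x₀ R z + (localIntegral Φ x₀ R x + m * T)) ∂ν :=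
          lintegral_mono_ae (hx'.mono fun z hz => hz.trans_eq (by ring))
      _ = V⁻¹ * (∫⁻ z in Metric.ball x₀ R, localIntegral Φ x₀ R z) +
            (localIntegral Φ x₀ R x + m * T) := by
          rw [lintegral_add_right _ measurable_const, lintegral_const, measure_univ, mul_one, hν,
            lintegral_smul_measure, smul_eq_mul]
      _ ≤ V⁻¹ * L + (localIntegral Φ x₀ R x + m * T) := by gcongr
      _ = _ := by ring
  calc _ ≤ _ := lintegral_mono_ae hpt
    _ = (∫⁻ x in Metric.ball x₀ R, localIntegral Φ x₀ R x) + (m * T + V⁻¹ * L) * V := by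
        rw [lintegral_add_right _ measurable_const, setLIntegral_const]
    _ ≤ L + (m * T + V⁻¹ * L) * V := by gcongr
    _ = L + m * T * V + L * (V⁻¹ * V) := by ring
    _ = _ := by rw [ENNReal.inv_mul_cancel hV0 hVt]; ring

end ModuloConstants

/-! ### Application to the commutator: measurability, convergent integrals, normalisation. -/

theorem MemLambda.continuous {n : ℕ} {𝕜 : Type*} [RCLike 𝕜] {δ : ℝ} (hδ : 0 < δ) {b : Sp n → 𝕜}
    (hb : MemLambda δ b) : Continuous b := by
  obtain ⟨C, hC⟩ := hb
  refine continuous_iff_continuousAt.2 fun x => ?_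
  rw [ContinuousAt, tendsto_iff_norm_sub_tendsto_zero]
  refine squeeze_zero (fun _ => norm_nonneg _) (fun y => hC y x) ?_
  have h : Continuous fun y : Sp n => C * ‖y - x‖ ^ δ :=
    continuous_const.mul ((by fun_prop : Continuous fun y : Sp n => ‖y - x‖).rpow_const
      fun _ => Or.inr hδ.le)
  simpa [hδ.ne'] using h.tendsto x

theorem aestronglyMeasurable_commIntegrand {n m : ℕ} {𝕜 : Type*} [RCLike 𝕜]
    {K : Sp n → (Fin m → Sp n) → 𝕜}
    (hK : AEStronglyMeasurable (fun q : Sp n × (Fin m → Sp n) => K q.1 q.2) volume)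
    {b : Fin m → Sp n → 𝕜} (hb : ∀ i, Continuous (b i)) {f : Fin m → Sp n → 𝕜}
    (hf : ∀ i, AEStronglyMeasurable (f i)) (j : Fin m) :
    AEStronglyMeasurable
      (fun q : Sp n × (Fin m → Sp n) => commIntegrand K b f j q.1 q.2) volume := by
  have hbj : Continuous fun q : Sp n × (Fin m → Sp n) => b j q.1 - b j (q.2 j) :=
    ((hb j).comp continuous_fst).sub ((hb j).comp ((continuous_apply j).comp continuous_snd))
  refine (hbj.aestronglyMeasurable.mul hK).mul
    (Finset.aestronglyMeasurable_fun_prod _ fun i _ => ?_)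
  exact (hf i).comp_quasiMeasurePreserving
    ((Measure.quasiMeasurePreserving_eval (fun _ : Fin m => (volume : Measure (Sp n))) i).comp
      Measure.quasiMeasurePreserving_snd)

/-- Where all the integrals converge, the sum commutator is a version of the sum commutator modulo
constants. -/
theorem SumCommutatorConverges.isSumCommutatorModConst {n m : ℕ} {𝕜 : Type*} [RCLike 𝕜]
    {K : Sp n → (Fin m → Sp n) → 𝕜} {b : Fin m → Sp n → 𝕜} {f : Fin m → Sp n → 𝕜}
    (h : SumCommutatorConverges K b f) :
    IsSumCommutatorModConst K b f (sumCommutator K b f) := by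
  have hcomm : ∀ j x y, commIntegrand K b f j x y =
      b j x * opIntegrand K f x y - opIntegrand K (mulEntry (b j) j f) x y := by
    intro j x y
    have : ∏ i, mulEntry (b j) j f i (y i) = b j (y j) * ∏ i, f i (y i) := by
      rw [← Finset.mul_prod_erase _ _ (Finset.mem_univ j),
        ← Finset.mul_prod_erase Finset.univ (fun i => f i (y i)) (Finset.mem_univ j),
        mulEntry, Function.update_self, mul_assoc]
      congr 2
      refine Finset.prod_congr rfl fun i hi => ?_
      rw [Function.update_of_ne (Finset.ne_of_mem_erase hi)]
    simp only [commIntegrand, opIntegrand, this]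
    ring
  have hint : ∀ x, (Integrable (opIntegrand K f x) ∧
      ∀ j, Integrable (opIntegrand K (mulEntry (b j) j f) x)) →
      ∀ j, Integrable (commIntegrand K b f j x) ∧
        ∫ y, commIntegrand K b f j x y = commutatorAt (b j) (op K) j f x := by
    intro x hx j
    have e : commIntegrand K b f j x = fun y =>
        b j x * opIntegrand K f x y - opIntegrand K (mulEntry (b j) j f) x y :=
      funext fun y => hcomm j x y
    rw [e]
    refine ⟨(hx.1.const_mul _).sub (hx.2 j), ?_⟩
    rw [integral_sub (hx.1.const_mul _) (hx.2 j), integral_const_mul]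
    rfl
  filter_upwards [Measure.quasiMeasurePreserving_fst.ae h,
    Measure.quasiMeasurePreserving_snd.ae h] with q h1 h2
  refine ⟨fun j => (hint _ h1 j).1.sub (hint _ h2 j).1, ?_⟩
  rw [sumCommutator, sumCommutator, ← Finset.sum_sub_distrib]
  refine Finset.sum_congr rfl fun j _ => ?_
  rw [integral_sub (hint _ h1 j).1 (hint _ h2 j).1, (hint _ h1 j).2, (hint _ h2 j).2]

/-- Keeps the bound in `ℍ_m` from degenerating to `0 * ∞`, so that it forces the product of weight
factors to be finite. -/
theorem ballSup_ne_zero {n : ℕ} {w : Sp n → ℝ} (hw : IsWeight w) (x : Sp n) {R : ℝ} (hR : 0 < R) :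
    ballSup w x R ≠ 0 := by
  intro h
  have hm : AEStronglyMeasurable ((Metric.ball x R).indicator w) :=
    hw.1.aestronglyMeasurable.indicator measurableSet_ball
  rw [ballSup, eLpNorm_eq_zero_iff hm (by simp)] at h
  have : ∀ᵐ y : Sp n, y ∉ Metric.ball x R := by
    filter_upwards [h, hw.2] with y hy hy' hmem
    rw [Set.indicator_of_mem hmem] at hy
    exact hy'.ne' hy
  have h0 : volume (Metric.ball x R) = 0 := by
    rw [ae_iff] at this
    simpa only [not_not, Set.ofPred_mem_eq] using this
  exact (Metric.measure_ball_pos _ _ hR).ne' h0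

/-- The powers of the radius in terms of the measure of the ball. -/
theorem exists_rpow_radius_le {n : ℕ} (hn : 1 ≤ n) (t : ℝ) :
    ∃ C : ℝ≥0, ∀ (x : Sp n) (R : ℝ), 0 < R →
      ENNReal.ofReal R ^ t = C * volume (Metric.ball x R) ^ (t / n) := by
  have hn0 : (0 : ℝ) < n := by exact_mod_cast hn
  set ω := volume (Metric.ball (0 : Sp n) 1)
  have hω0 : ω ≠ 0 := (Metric.measure_ball_pos _ _ one_pos).ne'
  have hωt : ω ≠ ∞ := measure_ball_lt_top.ne
  have hne : ω ^ (-(t / n)) ≠ ∞ := ENNReal.rpow_ne_top_of_ne_zero hω0 hωt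
  refine ⟨(ω ^ (-(t / n))).toNNReal, fun x R hR => ?_⟩
  rw [ENNReal.coe_toNNReal hne, volume_ball_eq hn x hR,
    ENNReal.mul_rpow_of_ne_top (by finiteness) hωt, ← ENNReal.rpow_mul, mul_div_cancel₀ _ hn0.ne',
    mul_left_comm, ← ENNReal.rpow_add _ _ hω0 hωt]
  simp

end MultiFrac

end

/-! ### The main theorem. -/

theorem theorem1p1 {𝕜 : Type*} [RCLike 𝕜] (n m : ℕ) (α γ δ δ' : ℝ)
    (hα : 0 < α) (hα' : α < m * n) (hγ : 0 < γ) (hγ' : γ ≤ 1)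
    (K : MultiFrac.Sp n → (Fin m → MultiFrac.Sp n) → 𝕜)
    (hKm : AEStronglyMeasurable (fun q : MultiFrac.Sp n × (Fin m → MultiFrac.Sp n) => K q.1 q.2) volume)
    (hKsize : MultiFrac.SizeCondition α K) (hKsmooth : MultiFrac.SmoothnessCondition α γ K)
    (hδ : 0 < δ) (hδ' : δ < min γ (m * n - α))
    (p : Fin m → ℝ≥0∞) (hp : ∀ i, 1 ≤ p i)
    (hp' : ENNReal.ofReal (n / (α + δ)) < (∑ i, (p i)⁻¹)⁻¹)
    (b : Fin m → MultiFrac.Sp n → 𝕜) (hb : ∀ i, MultiFrac.MemLambda δ (b i))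
    (hδδ' : δ' ≤ δ)
    (w : MultiFrac.Sp n → ℝ) (v : Fin m → MultiFrac.Sp n → ℝ)
    (hw : MultiFrac.IsWeight w) (hv : ∀ i, MultiFrac.IsWeight (v i))
    (hH : MultiFrac.HClass p (α + δ) δ δ' w v)
    (hRH : ∀ i, 1 < p i →
      MultiFrac.ReverseHolder m (fun y => v i y ^ (-(p i).conjExponent.toReal))) :
    ∃ C : ℝ≥0, 0 < C ∧ ∀ f : Fin m → MultiFrac.Sp n → 𝕜,
      (∀ i, MemLp (fun y => v i y • f i y) (p i) volume) →
        (MultiFrac.SumCommutatorConverges K b f →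
          MultiFrac.WeightedLipWith w δ' (C * ∏ i, eLpNorm (fun y => v i y • f i y) (p i) volume)
            (MultiFrac.sumCommutator K b f)) ∧
        (∃ g, MultiFrac.IsSumCommutatorModConst K b f g) ∧
        (∀ g, MultiFrac.IsSumCommutatorModConst K b f g →
          MultiFrac.WeightedLipWith w δ' (C * ∏ i, eLpNorm (fun y => v i y • f i y) (p i) volume)
            g) := by
  open MultiFrac in
  have hmn : 0 < m * n := by
    have : (0 : ℝ) < m * n := hα.trans hα'
    exact_mod_cast this
  have hm : 1 ≤ m := Nat.pos_of_mul_pos_right hmn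
  have hn : 1 ≤ n := Nat.pos_of_mul_pos_left hmn
  have hn0 : (0 : ℝ) < n := by exact_mod_cast hn
  have hm0 : (0 : ℝ) < m := by exact_mod_cast hm
  have hδγ : δ < γ := hδ'.trans_le (min_le_left _ _)
  have hδα : δ < m * n - α := hδ'.trans_le (min_le_right _ _)
  have hαδ : 0 < α + δ := by linarith
  have : ∀ i, ENNReal.HolderConjugate (p i) (p i).conjExponent :=
    fun i => ENNReal.HolderConjugate.conjExponent (hp i)
  have hpsum : n * ∑ i, (p i)⁻¹.toReal < α + δ := by
    have hfin : ∀ i ∈ Finset.univ, (p i)⁻¹ ≠ ∞ := fun i _ =>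
      ENNReal.inv_ne_top.2 (zero_lt_one.trans_le (hp i)).ne'
    rw [← ENNReal.toReal_sum hfin]
    have h1 := ENNReal.inv_lt_inv.2 hp'
    rw [inv_inv, ← ENNReal.ofReal_inv_of_pos (by positivity)] at h1
    have h2 := (ENNReal.lt_ofReal_iff_toReal_lt (ENNReal.sum_ne_top.2 hfin)).1 h1
    rw [inv_div, lt_div_iff₀ hn0] at h2
    linarith
  obtain ⟨A₀, hA₀⟩ := hKsize
  obtain ⟨B₀, hB₀⟩ := hKsmooth
  choose D₀ hD₀ using hb
  -- The given constants may be negative; they are replaced by nonnegative ones, and `D` serves all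
  -- the `b j` at once.
  set A := max A₀ 0
  set B := max B₀ 0
  set D := ∑ i, max (D₀ i) 0
  have hA : 0 ≤ A := le_max_right _ _
  have hB : 0 ≤ B := le_max_right _ _
  have hD : 0 ≤ D := Finset.sum_nonneg fun i _ => le_max_right _ _
  have hK : ∀ (x : Sp n) (y : Fin m → Sp n), 0 < ∑ i, ‖x - y i‖ →
      ‖K x y‖ ≤ A / (∑ i, ‖x - y i‖) ^ (m * n - α) := fun x y hxy =>
    (hA₀ x y hxy).trans (div_le_div_of_nonneg_right (le_max_left _ _) (by positivity))
  have hK' : ∀ (x x' : Sp n) (y : Fin m → Sp n), (∃ i, 2 * ‖x - x'‖ < ‖x - y i‖) →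
      ‖K x y - K x' y‖ ≤ B * ‖x - x'‖ ^ γ / (∑ i, ‖x - y i‖) ^ (m * n - α + γ) :=
    fun x x' y hxy => (hB₀ x x' y hxy).trans (div_le_div_of_nonneg_right
      (mul_le_mul_of_nonneg_right (le_max_left _ _) (by positivity)) (by positivity))
  have hbD : ∀ j x y, ‖b j x - b j y‖ ≤ D * ‖x - y‖ ^ δ := fun j x y =>
    (hD₀ j x y).trans (mul_le_mul_of_nonneg_right ((le_max_left _ _).trans
      (Finset.single_le_sum (f := fun i => max (D₀ i) 0) (fun i _ => le_max_right _ _)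
        (Finset.mem_univ j))) (by positivity))
  have hbc : ∀ i, Continuous (b i) := fun i => MemLambda.continuous hδ ⟨D₀ i, hD₀ i⟩
  obtain ⟨βs, hβs, hβsum, CH, hCH⟩ := hH
  -- The exponents of `ℍ_m`. Their sum is `mn - (α + δ) + δ = mn - α`, the homogeneity of `K`.
  set e : Fin m → ℝ := fun i => n - βs i + δ / m
  have he : ∀ i, 0 ≤ e i := fun i => by
    have := (hβs i).2
    have : 0 ≤ δ / m := by positivity
    simp only [e]; linarith
  have hesum : ∑ i, e i = m * n - α := by
    simp only [e]
    rw [Finset.sum_add_distrib, Finset.sum_sub_distrib, hβsum]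
    simp only [Finset.sum_const, Finset.card_univ, Fintype.card_fin, nsmul_eq_mul]
    field_simp
    ring
  obtain ⟨CL, hCL⟩ := exists_lintegral_localCube_le (K := K) (b := b) (e := e) hn hm hA hD hK hbD
    hδ.le hαδ (by linarith) hpsum hv hRH he hesum
  obtain ⟨CT, hCT⟩ := exists_lintegral_compl_localCube_le (K := K) (b := b) (e := e) (p := p)
    (q := fun i => (p i).conjExponent) hn hA hB hD hK hK' hbD hδ.le hδγ.le hv he hesum
  set W : Sp n → ℝ → ℝ≥0∞ := fun x R => ∏ i, weightFactor (v i) (p i).conjExponent (e i) x R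
  have hWC : ∀ x R, 0 < R →
      ballSup w x R / volume (Metric.ball x R) ^ ((δ' - δ) / n) * W x R ≤ CH := hCH
  have hW : ∀ x R, 0 < R → W x R ≠ ∞ := by
    intro x R hR h
    have h1 := hWC x R hR
    rw [h, ENNReal.mul_top] at h1
    · exact ENNReal.coe_ne_top (top_le_iff.1 h1)
    · refine ENNReal.div_ne_zero.2 ⟨ballSup_ne_zero hw x hR, ?_⟩
      exact ENNReal.rpow_ne_top_of_ne_zero (Metric.measure_ball_pos _ _ hR).ne'
        measure_ball_lt_top.ne
  obtain ⟨C₁, hC₁⟩ := exists_rpow_radius_le hn (n + δ)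
  obtain ⟨C₂, hC₂⟩ := exists_rpow_radius_le hn δ
  -- The two terms come from the doubled local part and from the `m` tails; the added `1` makes the
  -- constant positive.
  refine ⟨(2 * CL * C₁ + m * CT * C₂) * CH + 1, by positivity, fun f hf => ?_⟩
  set P := ∏ i, eLpNorm (fun y => v i y • f i y) (p i) volume with hP
  have hPt : P ≠ ∞ := ENNReal.prod_ne_top fun i _ => (hf i).2.ne
  have hfm : ∀ i, AEStronglyMeasurable (f i) := fun i =>
    (hv i).aestronglyMeasurable_of_smul (hf i).1
  have hΦ := aestronglyMeasurable_commIntegrand hKm hbc hfm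
  have hL : ∀ x₀ R, 0 < R → ∫⁻ x in Metric.ball x₀ R, localIntegral (commIntegrand K b f) x₀ R x ≤
      CL * ENNReal.ofReal R ^ (n + δ) * (P * W x₀ R) :=
    fun x₀ R hR => hCL x₀ R hR f fun i => (hf i).1
  have hT : ∀ x₀ R, 0 < R → ∀ x ∈ Metric.ball x₀ R, ∀ z ∈ Metric.ball x₀ R, ∀ j,
      ∫⁻ y in (localCube m x₀ R)ᶜ, ‖commIntegrand K b f j x y - commIntegrand K b f j z y‖ₑ ≤
        CT * ENNReal.ofReal R ^ δ * (P * W x₀ R) :=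
    fun x₀ R hR => hCT x₀ R hR f fun i => (hf i).1
  have hLt : ∀ x₀ R, 0 < R → CL * ENNReal.ofReal R ^ (n + δ) * (P * W x₀ R) ≠ ∞ :=
    fun x₀ R hR => ENNReal.mul_ne_top (by finiteness) (ENNReal.mul_ne_top hPt (hW x₀ R hR))
  have hTt : ∀ x₀ R, 0 < R → CT * ENNReal.ofReal R ^ δ * (P * W x₀ R) ≠ ∞ :=
    fun x₀ R hR => ENNReal.mul_ne_top (by finiteness) (ENNReal.mul_ne_top hPt (hW x₀ R hR))
  have hmain : ∀ g, IsSumCommutatorModConst K b f g →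
      WeightedLipWith w δ' (((2 * CL * C₁ + m * CT * C₂) * CH + 1 : ℝ≥0) * P) g := by
    intro g hg
    have hg : HasDifferences (commIntegrand K b f) g := hg
    have hball : ∀ x₀ R, 0 < R → IntegrableOn g (Metric.ball x₀ R) := fun x₀ R hR =>
      hg.integrableOn_ball hΦ hL hLt hT hTt x₀ hR
    refine ⟨fun x => ⟨Metric.ball x 1, Metric.ball_mem_nhds x one_pos, hball x 1 one_pos⟩, ?_⟩
    intro x R hR
    have h1 := hg.lintegral_ball_enorm_sub_average_le hΦ hR (hL x R hR) (hT x R hR) (hball x R hR)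
    set V := volume (Metric.ball x R)
    have hV0 : V ≠ 0 := (Metric.measure_ball_pos _ _ hR).ne'
    have hVt : V ≠ ∞ := measure_ball_lt_top.ne
    have eV : V ^ ((n + δ) / n) = V ^ (δ / n) * V := by
      rw [add_div, div_self hn0.ne', add_comm, ENNReal.rpow_add _ _ hV0 hVt, ENNReal.rpow_one]
    -- Local and tail contributions both scale like `|B|^{1+δ/n}`; dividing by `|B|^{1+δ'/n}` leaves
    -- precisely the normalisation of `ℍ_m`.
    have eV' : V ^ (δ / n) * V / V ^ (1 + δ' / n) = (V ^ ((δ' - δ) / n))⁻¹ := by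
      have : (δ' - δ) / n = 1 + δ' / n - ((n + δ) / n) := by field_simp; ring
      rw [← eV, this, ← ENNReal.rpow_sub _ _ hV0 hVt, ← ENNReal.rpow_neg, neg_sub]
    rw [hC₁ x R hR, hC₂ x R hR, eV] at h1
    calc ballSup w x R / V ^ (1 + δ' / n) *
          ∫⁻ y in Metric.ball x R, ‖g y - ⨍ z in Metric.ball x R, g z‖ₑ
        ≤ ballSup w x R / V ^ (1 + δ' / n) *
          (2 * (CL * (C₁ * (V ^ (δ / n) * V)) * (P * W x R)) +
            m * (CT * (C₂ * V ^ (δ / n)) * (P * W x R)) * V) := by gcongr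
      _ = (2 * CL * C₁ + m * CT * C₂) *
          (ballSup w x R * (V ^ (δ / n) * V / V ^ (1 + δ' / n)) * W x R) * P := by
          simp only [div_eq_mul_inv]; ring
      _ ≤ (2 * CL * C₁ + m * CT * C₂) * CH * P := by
          rw [eV']
          gcongr
          exact hWC x R hR
      _ ≤ _ := by
          push_cast
          gcongr
          exact le_self_add
  refine ⟨fun h => hmain _ h.isSumCommutatorModConst, ?_, hmain⟩
  exact exists_hasDifferences hΦ hL hLt hT hTt
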